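/- For elements $x,y$ of a group put $[x,y]=x^{-1}y^{-1}xy$, $[x,{}_1y]=[x,y]$ and $[x,{}_{i+1}y]=[[x,{}_iy],y]$ for $i\ge 1$. A multilinear commutator word is a group-word obtained from pairwise distinct variables by nested commutators with an arbitrary bracketing (a single variable is included; each variable occurs exactly once in the commutator expression). For a word $v$ and a group $G$, a $v$-value is an element of $G$ obtained by substituting elements of $G$ for the variables of $v$, and $v(G)$ is the subgroup generated by all $v$-values in $G$. Let $w=w(x_1,\dots,x_k)$ be a multilinear commutator word, let $n,q$ be positive integers, and let $v=[w^q,{}_ny]$, where $y$ is a variable different from $x_1,\dots,x_k$. Then for all positive integers $m,s,e$ there is a number $\nu=\nu(v,m,s,e)$ such that the following holds: if $G$ is any group that has a normal soluble subgroup of index $e$ and derived length at most $s$, and if there are at most $m$ distinct $v$-values in $G$, then $v(G)$ is finite of order at most $\nu$. -/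

import Mathlib

/-- The group commutator `[x, y] = x⁻¹ y⁻¹ x y`.  (Mathlib's `⁅x, y⁆` is `x y x⁻¹ y⁻¹`.) -/
def groupComm {G : Type*} [Group G] (x y : G) : G :=
  x⁻¹ * y⁻¹ * x * y

/-- The iterated commutator `[x, ₙy]`, with `[x, ₀y] = x` and `[x, ₙ₊₁y] = [[x, ₙy], y]`. -/
def engelComm {G : Type*} [Group G] (x y : G) : ℕ → G
  | 0 => x
  | n + 1 => groupComm (engelComm x y n) y

/-- `MultilinearCommOn w S`: the word `w` is an iterated commutator (with an arbitrary bracketing)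
of distinct variables, and `S` is the set of the variables that occur in it. -/
inductive MultilinearCommOn {α : Type*} : FreeGroup α → Set α → Prop
  | var (i : α) : MultilinearCommOn (FreeGroup.of i) {i}
  | comm {u v : FreeGroup α} {S T : Set α} :
      MultilinearCommOn u S → MultilinearCommOn v T → Disjoint S T →
      MultilinearCommOn (groupComm u v) (S ∪ T)

/-- `w` is a multilinear commutator word (outer commutator word) in the variables `α`. -/
def IsMultilinearComm {α : Type*} (w : FreeGroup α) : Prop :=
  ∃ S : Set α, MultilinearCommOn w S

/-- The word `[w^q, ₙy]` in the variables of `w` (these are `some i`) and a new variable `y`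
(this is `none`). -/
def powEngelWord {α : Type*} (w : FreeGroup α) (q n : ℕ) : FreeGroup (Option α) :=
  engelComm (FreeGroup.map some w ^ q) (FreeGroup.of none) n

/-- The set `G_v` of all values of the word `v` in the group `G`. -/
def wordValues {α : Type*} (v : FreeGroup α) (G : Type*) [Group G] : Set G :=
  Set.range fun g : α → G => FreeGroup.lift g v

/-- The verbal subgroup `v(G)`, generated by all values of `v` in `G`. -/
def verbalSubgroup {α : Type*} (v : FreeGroup α) (G : Type*) [Group G] : Subgroup G :=
  Subgroup.closure (wordValues v G)

/-! If the bound failed, there would be counterexamples of every size, and their ultraproduct would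
be a soluble-by-finite group `G` with finitely many values of `[w ^ q, ₙy]` and an infinite verbal
subgroup (`exists_card_bound`). So it is enough to show that finitely many values generate a finite
group (`VirtSol.finite_closure_engelValues`). A finitely generated torsion soluble-by-finite group
is finite; hence one may factor out the largest normal torsion subgroup, and has to show that all
values are trivial if `G` has no nontrivial normal torsion subgroup.

Consider the commutators of the terms of the derived series of a soluble normal subgroup of finite
index, bracketed as in `w` (`CommTree.sub`). Modulo the products of those commutator subgroups in
which some entry has gone one term further down, the word `w` is multiplicative in a variable whose
term is lowest (`CommTree.eval_update_mul`). So the powers of a `w`-value there are `w`-values, and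
since there are finitely many values of `[w ^ q, ₙy]`, all `[x, ₙy]` with `x` in that factor are
torsion. Together with one torsion factor, which accounts for the finite quotient
(`torsionMod_sup_commutator`), this gives a chain of normal subgroups from `1` to `w(G)` whose
factors are torsion, or abelian and modulo torsion unipotent under the action of `G`
(`tameChain_bot_sub`).

A soluble-by-finite group that acts unipotently with bounded exponent on a torsion-free abelian
group acts nilpotently (`VirtSol.exists_iterComm_eq_bot`). The case of commuting automorphisms is
the identity `(k + 2) • (a ^ (k + 1) * b ^ (k + 1)) = 0` for commuting `a`, `b` such that
`a`, `b` and `(1 + a) * (1 + b) - 1` are nilpotent of exponent `k + 2`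
(`smul_pow_mul_pow_eq_zero`). As there is no normal torsion, one may climb the chain, replacing each
term by its torsion closure, and finds that `w(G)` is torsion-free and that `[w(G), G, …, G] = 1`
for some number of entries (`TameChain.torsionFree_and_exists_iterComm`).

Finally let `u` be a `q`-th power of a `w`-value and `y` any element. The constant sequences `u`,
`y` and the sequence `j ↦ y ^ j` generate a nilpotent group of sequences, on which the shift acts
nilpotently by Hall's criterion (`exists_engelComm_eq_one`). In other words, some iterated
multiplicative difference of `j ↦ [u, ₙy ^ j]` is trivial. A sequence with this property which takes
finitely many values in a torsion-free group is constant (`eq_of_diffSeq_iterate_eq_one`), so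
`[u, ₙy] = [u, ₙ1] = 1` (`engelComm_eq_one_of_finite`). -/

namespace VerbalEngel

open Subgroup Relation
open scoped commutatorElement

/-! ### Commutators and Engel commutators -/

section Commutators

variable {G H : Type*} [Group G] [Group H]

theorem groupComm_eq (x y : G) : groupComm x y = ⁅x⁻¹, y⁻¹⁆ := by
  simp [groupComm, commutatorElement_def]

theorem groupComm_eq_one_iff {x y : G} : groupComm x y = 1 ↔ Commute x y := by
  rw [groupComm_eq, commutatorElement_eq_one_iff_commute, Commute.inv_left_iff,
    Commute.inv_right_iff]

theorem map_groupComm (f : G →* H) (x y : G) :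
    f (groupComm x y) = groupComm (f x) (f y) := by
  simp [groupComm]

theorem map_engelComm (f : G →* H) (x y : G) (n : ℕ) :
    f (engelComm x y n) = engelComm (f x) (f y) n := by
  induction n with
  | zero => rfl
  | succ n ih => simp [engelComm, map_groupComm, ih]

theorem groupComm_mem {A B : Subgroup G} {x y : G} (hx : x ∈ A) (hy : y ∈ B) :
    groupComm x y ∈ ⁅A, B⁆ := by
  rw [groupComm_eq]
  exact commutator_mem_commutator (inv_mem hx) (inv_mem hy)

theorem groupComm_mem_left {V : Subgroup G} (hV : V.Normal) {x : G} (hx : x ∈ V) (y : G) :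
    groupComm x y ∈ V := by
  have h := V.mul_mem (V.inv_mem hx) (hV.conj_mem x hx y⁻¹)
  simpa [groupComm, mul_assoc] using h

theorem engelComm_mem {V : Subgroup G} (hV : V.Normal) {x : G} (hx : x ∈ V) (y : G) (n : ℕ) :
    engelComm x y n ∈ V := by
  induction n with
  | zero => exact hx
  | succ n ih => exact groupComm_mem_left hV ih y

theorem engelComm_one_left (y : G) (n : ℕ) : engelComm 1 y n = 1 := by
  induction n with
  | zero => rfl
  | succ n ih => simp [engelComm, ih, groupComm]

theorem groupComm_mul_of_commute {V : Subgroup G} (hV : V.Normal)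
    (hc : ∀ a ∈ V, ∀ b ∈ V, Commute a b) {a b : G} (ha : a ∈ V) (hb : b ∈ V) (y : G) :
    groupComm (a * b) y = groupComm a y * groupComm b y := by
  have h := hc _ (V.inv_mem hb) _ (groupComm_mem_left hV ha y)
  have e : groupComm (a * b) y = b⁻¹ * groupComm a y * (y⁻¹ * b * y) := by
    simp [groupComm, mul_assoc]
  rw [e, h.eq]
  simp [groupComm, mul_assoc]

/-- On an abelian normal subgroup `V` the map `x ↦ [x, ₙy]` is an endomorphism. -/
theorem engelComm_mul_of_commute {V : Subgroup G} (hV : V.Normal)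
    (hc : ∀ a ∈ V, ∀ b ∈ V, Commute a b) {a b : G} (ha : a ∈ V) (hb : b ∈ V) (y : G) (n : ℕ) :
    engelComm (a * b) y n = engelComm a y n * engelComm b y n := by
  induction n with
  | zero => rfl
  | succ n ih =>
    simp only [engelComm]
    rw [ih, groupComm_mul_of_commute hV hc (engelComm_mem hV ha y n) (engelComm_mem hV hb y n)]

theorem engelComm_pow_of_commute {V : Subgroup G} (hV : V.Normal)
    (hc : ∀ a ∈ V, ∀ b ∈ V, Commute a b) {a : G} (ha : a ∈ V) (y : G) (n c : ℕ) :
    engelComm (a ^ c) y n = engelComm a y n ^ c := by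
  induction c with
  | zero => simp [engelComm_one_left]
  | succ c ih =>
    rw [pow_succ, pow_succ, engelComm_mul_of_commute hV hc (V.pow_mem ha c) ha, ih]

theorem engelComm_inv_of_commute {V : Subgroup G} (hV : V.Normal)
    (hc : ∀ a ∈ V, ∀ b ∈ V, Commute a b) {a : G} (ha : a ∈ V) (y : G) (n : ℕ) :
    engelComm a⁻¹ y n = (engelComm a y n)⁻¹ := by
  rw [eq_inv_iff_mul_eq_one, ← engelComm_mul_of_commute hV hc (V.inv_mem ha) ha,
    inv_mul_cancel, engelComm_one_left]

theorem commute_of_commutator_eq_bot {A B : Subgroup G} (h : ⁅A, B⁆ = ⊥) {a b : G}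
    (ha : a ∈ A) (hb : b ∈ B) : Commute a b := by
  rw [← commutatorElement_eq_one_iff_commute, ← mem_bot, ← h]
  exact commutator_mem_commutator ha hb

theorem commutator_eq_bot_of_commute {A B : Subgroup G}
    (h : ∀ a ∈ A, ∀ b ∈ B, Commute a b) : ⁅A, B⁆ = ⊥ := by
  rw [eq_bot_iff, commutator_le]
  intro a ha b hb
  rw [mem_bot, commutatorElement_eq_one_iff_commute]
  exact h a ha b hb

theorem map_mk_eq_bot_iff {E K : Subgroup G} [E.Normal] :
    K.map (QuotientGroup.mk' E) = ⊥ ↔ K ≤ E := by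
  rw [Subgroup.map_eq_bot_iff, QuotientGroup.ker_mk']

theorem commutator_le_iff_le_comap {E A C : Subgroup G} [E.Normal] :
    ⁅A, C⁆ ≤ E ↔ A ≤ (centralizer (C.map (QuotientGroup.mk' E) : Set (G ⧸ E))).comap
      (QuotientGroup.mk' E) := by
  rw [← map_mk_eq_bot_iff, map_commutator, commutator_eq_bot_iff_le_centralizer,
    map_le_iff_le_comap]

theorem sup_commutator_le {E A B C : Subgroup G} [E.Normal] (hA : ⁅A, C⁆ ≤ E)
    (hB : ⁅B, C⁆ ≤ E) : ⁅A ⊔ B, C⁆ ≤ E := by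
  rw [commutator_le_iff_le_comap] at *
  exact sup_le hA hB

theorem commutator_sup_le {E A B C : Subgroup G} [E.Normal] (hA : ⁅C, A⁆ ≤ E)
    (hB : ⁅C, B⁆ ≤ E) : ⁅C, A ⊔ B⁆ ≤ E := by
  rw [commutator_comm] at *
  exact sup_commutator_le hA hB

theorem iSup_commutator_le {ι : Sort*} {E C : Subgroup G} [E.Normal] {A : ι → Subgroup G}
    (hA : ∀ i, ⁅A i, C⁆ ≤ E) : ⁅⨆ i, A i, C⁆ ≤ E := by
  rw [commutator_le_iff_le_comap]
  exact iSup_le fun i => commutator_le_iff_le_comap.1 (hA i)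

/-- To bound `⁅⟨S⟩, ⟨T⟩⁆` by a normal subgroup it suffices to look at the generators. -/
theorem closure_commutator_closure_le {E : Subgroup G} [E.Normal] {S T : Set G}
    (h : ∀ s ∈ S, ∀ t ∈ T, ⁅s, t⁆ ∈ E) : ⁅closure S, closure T⁆ ≤ E := by
  rw [← map_mk_eq_bot_iff, map_commutator, MonoidHom.map_closure, MonoidHom.map_closure,
    commutator_eq_bot_iff_le_centralizer, closure_le]
  rintro _ ⟨s, hs, rfl⟩
  have hle : closure (QuotientGroup.mk' E '' T) ≤ centralizer {QuotientGroup.mk' E s} := by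
    rw [closure_le]
    rintro _ ⟨t, ht, rfl⟩
    rw [SetLike.mem_coe, mem_centralizer_singleton_iff]
    have h1 : QuotientGroup.mk' E ⁅s, t⁆ = 1 := (QuotientGroup.eq_one_iff _).2 (h s hs t ht)
    rw [map_commutatorElement, commutatorElement_eq_one_iff_mul_comm] at h1
    exact h1.symm
  rw [SetLike.mem_coe, mem_centralizer_iff]
  intro x hx
  exact mem_centralizer_singleton_iff.1 (hle hx)

/-- The three subgroups lemma relative to a normal subgroup. -/
theorem three_subgroups_le {E A B C : Subgroup G} [E.Normal] (h1 : ⁅⁅A, C⁆, B⁆ ≤ E)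
    (h2 : ⁅A, ⁅B, C⁆⁆ ≤ E) : ⁅⁅A, B⁆, C⁆ ≤ E := by
  rw [commutator_comm] at h2
  rw [commutator_comm A C] at h1
  rw [← map_mk_eq_bot_iff] at *
  simp only [map_commutator] at *
  exact commutator_commutator_eq_bot_of_rotate h2 h1

/-- The iterated commutator subgroup `[V, D, …, D]` with `t` entries `D`. -/
def iterComm (V D : Subgroup G) : ℕ → Subgroup G
  | 0 => V
  | t + 1 => ⁅iterComm V D t, D⁆

theorem iterComm_mono {V V' D D' : Subgroup G} (hV : V ≤ V') (hD : D ≤ D') (t : ℕ) :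
    iterComm V D t ≤ iterComm V' D' t := by
  induction t with
  | zero => exact hV
  | succ t ih => exact commutator_mono ih hD

theorem iterComm_add (V D : Subgroup G) (a b : ℕ) :
    iterComm V D (a + b) = iterComm (iterComm V D a) D b := by
  induction b with
  | zero => rfl
  | succ b ih => rw [← add_assoc]; simp only [iterComm]; rw [ih]

theorem map_iterComm (f : G →* H) (V D : Subgroup G) (t : ℕ) :
    (iterComm V D t).map f = iterComm (V.map f) (D.map f) t := by
  induction t with
  | zero => rfl
  | succ t ih => simp only [iterComm]; rw [map_commutator, ih]

theorem iterComm_normal {V D : Subgroup G} (hV : V.Normal) (hD : D.Normal) (t : ℕ) :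
    (iterComm V D t).Normal := by
  induction t with
  | zero => exact hV
  | succ t ih => simp only [iterComm]; infer_instance

theorem engelComm_mem_iterComm {V D : Subgroup G} {x y : G} (hx : x ∈ V) (hy : y ∈ D) (n : ℕ) :
    engelComm x y n ∈ iterComm V D n := by
  induction n with
  | zero => exact hx
  | succ n ih => exact groupComm_mem ih hy

/-- If `[V, D, …, D] ≤ W` with `a` entries `D` and `[W, D, …, D] = 1` with `b` entries, then
`[V, D, …, D] = 1` with `a + b` entries. -/
theorem iterComm_eq_bot_of_quotient {V W D : Subgroup G} [W.Normal] {a b : ℕ}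
    (h1 : iterComm (V.map (QuotientGroup.mk' W)) (D.map (QuotientGroup.mk' W)) a = ⊥)
    (h2 : iterComm W D b = ⊥) : iterComm V D (a + b) = ⊥ := by
  rw [← map_iterComm, map_mk_eq_bot_iff] at h1
  rw [iterComm_add, eq_bot_iff, ← h2]
  exact iterComm_mono h1 le_rfl b

end Commutators

/-! ### Soluble-by-finite groups -/

section VirtuallySoluble

variable {G H : Type*} [Group G] [Group H]

/-- The derived series of a subgroup, as a series of subgroups of the whole group. -/
def derIter (N : Subgroup G) : ℕ → Subgroup G
  | 0 => N
  | d + 1 => ⁅derIter N d, derIter N d⁆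

theorem derIter_eq_map (N : Subgroup G) (d : ℕ) :
    derIter N d = (derivedSeries N d).map N.subtype := by
  induction d with
  | zero => simp [derIter, ← MonoidHom.range_eq_map]
  | succ d ih => rw [derIter, ih, derivedSeries_succ, map_commutator]

theorem derIter_normal {N : Subgroup G} (hN : N.Normal) (d : ℕ) : (derIter N d).Normal := by
  induction d with
  | zero => exact hN
  | succ d ih => simp only [derIter]; infer_instance

theorem map_derIter (f : G →* H) (N : Subgroup G) (d : ℕ) :
    (derIter N d).map f = derIter (N.map f) d := by
  induction d with
  | zero => rfl
  | succ d ih => simp only [derIter]; rw [map_commutator, ih]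

theorem derIter_mono {N M : Subgroup G} (h : N ≤ M) (d : ℕ) : derIter N d ≤ derIter M d := by
  induction d with
  | zero => exact h
  | succ d ih => exact commutator_mono ih ih

theorem derIter_succ' (N : Subgroup G) (d : ℕ) : derIter N (d + 1) = derIter ⁅N, N⁆ d := by
  induction d with
  | zero => rfl
  | succ d ih => rw [derIter, ih]; rfl

/-- `G` has a soluble normal subgroup of finite index. -/
def VirtSol (G : Type*) [Group G] : Prop :=
  ∃ N : Subgroup G, N.Normal ∧ N.FiniteIndex ∧ ∃ s, derIter N s = ⊥

theorem VirtSol.of_surjective (h : VirtSol G) (f : G →* H) (hf : Function.Surjective f) :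
    VirtSol H := by
  obtain ⟨N, hN, hi, s, hs⟩ := h
  refine ⟨N.map f, hN.map f hf, ⟨?_⟩, s, ?_⟩
  · exact fun h0 => hi.index_ne_zero (Nat.eq_zero_of_zero_dvd (h0 ▸ N.index_map_dvd hf))
  · rw [← map_derIter, hs, Subgroup.map_bot]

theorem VirtSol.subgroup (h : VirtSol G) (K : Subgroup G) : VirtSol K := by
  obtain ⟨N, hN, hi, s, hs⟩ := h
  refine ⟨N.subgroupOf K, inferInstance, inferInstance, s, ?_⟩
  rw [← map_eq_bot_iff_of_injective _ K.subtype_injective, map_derIter, eq_bot_iff, ← hs]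
  refine derIter_mono ?_ s
  rw [map_le_iff_le_comap]
  exact le_rfl

theorem finite_of_fg_of_torsion_of_derIter (d : ℕ) : ∀ (K : Type*) [Group K], Group.FG K →
    (∀ x : K, IsOfFinOrder x) → derIter (⊤ : Subgroup K) d = ⊥ → Finite K := by
  induction d with
  | zero =>
    intro K _ _ _ h
    have : Subsingleton K := Subgroup.subsingleton_iff.1 (subsingleton_of_bot_eq_top h.symm)
    infer_instance
  | succ d ih =>
    intro K _ hfg ht h
    have h0 : Group.FG (Abelianization K) :=
      inferInstanceAs (Group.FG (K ⧸ commutator K))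
    have h1 : Finite (Abelianization K) :=
      CommGroup.finite_of_fg_isMulTorsion (Abelianization K)
        (IsMulTorsion.of_surjective (f := Abelianization.of) (QuotientGroup.mk'_surjective _) ht)
    have h2 : (commutator K).FiniteIndex := by
      have : Finite (K ⧸ commutator K) := h1
      exact finiteIndex_of_finite_quotient
    have h3 : Group.FG (commutator K) := inferInstance
    have h4 : Finite (commutator K) := by
      refine ih (commutator K) h3 (fun x => ?_) ?_
      · exact (Submonoid.isOfFinOrder_coe (H := (commutator K).toSubmonoid)).1 (ht x)
      · rw [← map_eq_bot_iff_of_injective _ (commutator K).subtype_injective, map_derIter,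
          ← MonoidHom.range_eq_map, range_subtype]
        rw [derIter_succ'] at h
        exact h
    exact Finite.of_subgroup_quotient (commutator K)

/-- A finitely generated torsion soluble-by-finite group is finite. -/
theorem VirtSol.finite (h : VirtSol G) (hfg : Group.FG G) (ht : ∀ x : G, IsOfFinOrder x) :
    Finite G := by
  obtain ⟨N, hN, hi, s, hs⟩ := h
  have h1 : Finite N := by
    refine finite_of_fg_of_torsion_of_derIter s N inferInstance (fun x => ?_) ?_
    · exact (Submonoid.isOfFinOrder_coe (H := N.toSubmonoid)).1 (ht x)
    · rw [← map_eq_bot_iff_of_injective _ N.subtype_injective, map_derIter,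
          ← MonoidHom.range_eq_map, range_subtype, hs]
  have h2 : Finite (G ⧸ N) := finite_quotient_of_finiteIndex
  exact Finite.of_subgroup_quotient N

end VirtuallySoluble

/-! ### Torsion modulo a subgroup and the torsion radical -/

section Torsion

variable {G : Type*} [Group G]

/-- Every element of `M` has a positive power in `A`. -/
def TorsionMod (A M : Subgroup G) : Prop :=
  ∀ x ∈ M, ∃ l : ℕ, 0 < l ∧ x ^ l ∈ A

/-- The subgroup `M` contains no nontrivial element of finite order. -/
def TorsionFree (M : Subgroup G) : Prop :=
  ∀ x ∈ M, ∀ l : ℕ, 0 < l → x ^ l = 1 → x = 1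

/-- `G` has no nontrivial normal torsion subgroup. -/
def NoTorsionNormal (G : Type*) [Group G] : Prop :=
  ∀ M : Subgroup G, M.Normal → TorsionMod ⊥ M → M = ⊥

theorem TorsionMod.sup {A M N : Subgroup G} [A.Normal] [M.Normal] [N.Normal]
    (hM : TorsionMod A M) (hN : TorsionMod A N) : TorsionMod A (M ⊔ N) := by
  intro x hx
  rw [← SetLike.mem_coe, mul_normal, Set.mem_mul] at hx
  obtain ⟨a, ha, b, hb, rfl⟩ := hx
  obtain ⟨l, hl, hal⟩ := hM a ha
  -- modulo `N` the power `(a * b) ^ l` is `a ^ l`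
  have h1 : (a ^ l)⁻¹ * (a * b) ^ l ∈ N := by
    rw [← QuotientGroup.eq]
    have hb1 : (b : G ⧸ N) = 1 := (QuotientGroup.eq_one_iff b).2 hb
    simp [hb1]
  obtain ⟨l', hl', hbl⟩ := hN _ h1
  refine ⟨l * l', Nat.mul_pos hl hl', ?_⟩
  rw [← QuotientGroup.eq_one_iff] at hal hbl ⊢
  rw [QuotientGroup.mk_pow, QuotientGroup.mk_mul, QuotientGroup.mk_inv, hal, inv_one, one_mul]
    at hbl
  rw [pow_mul, QuotientGroup.mk_pow, hbl]

/-- The largest normal subgroup `R` that is torsion modulo `A`. The quotient by it has no normal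
torsion. -/
theorem exists_torsionRadical (A : Subgroup G) (hA : A.Normal) :
    ∃ R : Subgroup G, ∃ _ : R.Normal, A ≤ R ∧ TorsionMod A R ∧ NoTorsionNormal (G ⧸ R) := by
  let F : Set (Subgroup G) := {M | M.Normal ∧ TorsionMod A M}
  have hAF : A ∈ F := ⟨hA, fun x hx => ⟨1, one_pos, by simpa using hx⟩⟩
  have hdir : DirectedOn (· ≤ ·) F := by
    rintro M ⟨hM, hM'⟩ N ⟨hN, hN'⟩
    exact ⟨M ⊔ N, ⟨inferInstance, hM'.sup hN'⟩, le_sup_left, le_sup_right⟩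
  have hmem : ∀ x, x ∈ sSup F ↔ ∃ M ∈ F, x ∈ M := fun x => mem_sSup_of_directedOn ⟨A, hAF⟩ hdir
  have hR : (sSup F).Normal := by
    refine ⟨fun x hx g => ?_⟩
    obtain ⟨M, hM, hxM⟩ := (hmem x).1 hx
    exact (hmem _).2 ⟨M, hM, hM.1.conj_mem x hxM g⟩
  have hT : TorsionMod A (sSup F) := by
    intro x hx
    obtain ⟨M, hM, hxM⟩ := (hmem x).1 hx
    exact hM.2 x hxM
  refine ⟨sSup F, hR, le_sSup hAF, hT, ?_⟩
  intro M hM hMt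
  have h1 : M.comap (QuotientGroup.mk' (sSup F)) ∈ F := by
    refine ⟨hM.comap _, fun x hx => ?_⟩
    obtain ⟨l, hl, hxl⟩ := hMt _ hx
    rw [mem_bot, ← map_pow] at hxl
    obtain ⟨l', hl', hxl'⟩ := hT _ ((QuotientGroup.eq_one_iff _).1 hxl)
    exact ⟨l * l', Nat.mul_pos hl hl', by rwa [pow_mul]⟩
  have h2 := le_sSup h1
  rw [eq_bot_iff]
  intro x hx
  obtain ⟨g, rfl⟩ := QuotientGroup.mk'_surjective _ x
  exact (QuotientGroup.eq_one_iff g).2 (h2 hx)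

/-- Let `A` centralize `R` and let every element of `R` have a power in `A`. In a soluble-by-finite
group any two elements of `R` then generate a central-by-finite group, and the transfer to its
centre is a power map. -/
theorem exists_pow_mul (hG : VirtSol G) {A R : Subgroup G} [A.Normal]
    (hc : ⁅A, R⁆ = ⊥) (ht : TorsionMod A R) {a b : G} (ha : a ∈ R) (hb : b ∈ R) :
    ∃ r : ℕ, 0 < r ∧ (a * b) ^ r = a ^ r * b ^ r ∧ Commute (a ^ r) (b ^ r) ∧ ⁅a, b⁆ ^ r = 1 := by
  let K : Subgroup G := closure {a, b}
  have hKR : K ≤ R := by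
    rw [closure_le]; rintro x (rfl | rfl) <;> assumption
  have haK : a ∈ K := subset_closure (by simp)
  have hbK : b ∈ K := subset_closure (by simp)
  have hfg : Group.FG K := by
    rw [Group.fg_iff_subgroup_fg]
    classical exact ⟨{a, b}, by simp [K]⟩
  have hle : A.subgroupOf K ≤ center K := by
    intro x hx
    rw [mem_center_iff]
    intro g
    exact Subtype.ext (commute_of_commutator_eq_bot hc (mem_subgroupOf.1 hx) (hKR g.2)).eq.symm
  have hfin : Finite (K ⧸ A.subgroupOf K) := by
    refine VirtSol.finite ((hG.subgroup K).of_surjective (QuotientGroup.mk' _)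
      (QuotientGroup.mk'_surjective _)) inferInstance fun x => ?_
    obtain ⟨g, rfl⟩ := QuotientGroup.mk'_surjective _ x
    obtain ⟨l, hl, hgl⟩ := ht g (hKR g.2)
    rw [isOfFinOrder_iff_pow_eq_one]
    refine ⟨l, hl, ?_⟩
    rw [← map_pow]
    exact (QuotientGroup.eq_one_iff _).2 (mem_subgroupOf.2 (by simpa using hgl))
  have hfi : (A.subgroupOf K).FiniteIndex := finiteIndex_of_finite_quotient
  have hfc : (center K).FiniteIndex := finiteIndex_of_le hle
  let φ := MonoidHom.transferCenterPow K
  have hφ : ∀ g : K, ((φ g : K) : G) = (g : G) ^ (center K).index := fun g => by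
    rw [MonoidHom.transferCenterPow_apply]; rfl
  refine ⟨(center K).index, Nat.pos_of_ne_zero hfc.index_ne_zero, ?_, ?_, ?_⟩
  · have := hφ (⟨a, haK⟩ * ⟨b, hbK⟩)
    rw [map_mul] at this
    simpa [hφ] using this.symm
  · have h1 : φ ⟨a, haK⟩ * φ ⟨b, hbK⟩ = φ ⟨b, hbK⟩ * φ ⟨a, haK⟩ :=
      Subtype.ext ((mem_center_iff.1 (φ ⟨b, hbK⟩).2 _))
    have h2 := congrArg (fun z : center K => ((z : K) : G)) h1
    rw [commute_iff_eq]
    simpa [hφ] using h2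
  · have h0 : φ ⁅(⟨a, haK⟩ : K), (⟨b, hbK⟩ : K)⁆ = 1 := by
      rw [map_commutatorElement, commutatorElement_eq_one_iff_mul_comm]
      exact Subtype.ext (mem_center_iff.1 (φ ⟨b, hbK⟩).2 _)
    have := hφ ⁅(⟨a, haK⟩ : K), (⟨b, hbK⟩ : K)⁆
    rw [h0] at this
    simpa [commutatorElement_def] using this.symm

/-- In a soluble-by-finite group without normal torsion, a normal subgroup `R` all of whose elements
have a power in a normal subgroup centralizing `R` is abelian and torsion-free. -/
theorem commute_and_torsionFree (hG : VirtSol G) (hnt : NoTorsionNormal G) {A R : Subgroup G}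
    [A.Normal] (hR : R.Normal) (hc : ⁅A, R⁆ = ⊥) (ht : TorsionMod A R) :
    (∀ a ∈ R, ∀ b ∈ R, Commute a b) ∧ TorsionFree R := by
  let T : Subgroup G :=
    { carrier := {x | x ∈ R ∧ ∃ l : ℕ, 0 < l ∧ x ^ l = 1}
      one_mem' := ⟨R.one_mem, 1, one_pos, by simp⟩
      inv_mem' := by
        rintro x ⟨hx, l, hl, h⟩
        exact ⟨R.inv_mem hx, l, hl, by simp [h]⟩
      mul_mem' := by
        rintro x y ⟨hx, l, hl, h⟩ ⟨hy, l', hl', h'⟩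
        obtain ⟨r, hr, h1, h2, -⟩ := exists_pow_mul hG hc ht hx hy
        refine ⟨R.mul_mem hx hy, r * (l * l'), by positivity, ?_⟩
        rw [pow_mul, h1, h2.mul_pow, ← pow_mul, ← pow_mul,
          show r * (l * l') = l * (r * l') by ring, pow_mul x, h,
          show l * (r * l') = l' * (r * l) by ring, pow_mul y, h']
        simp }
  have hT : T.Normal := by
    refine ⟨?_⟩
    rintro x ⟨hx, l, hl, h⟩ g
    exact ⟨hR.conj_mem x hx g, l, hl, by simp [h]⟩
  have hbot : T = ⊥ := hnt T hT fun x hx => by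
    obtain ⟨-, l, hl, h⟩ := hx
    exact ⟨l, hl, by simpa using h⟩
  have htf : TorsionFree R := by
    intro x hx l hl h
    have : x ∈ T := ⟨hx, l, hl, h⟩
    rwa [hbot, mem_bot] at this
  refine ⟨fun a ha b hb => ?_, htf⟩
  obtain ⟨r, hr, -, -, h⟩ := exists_pow_mul hG hc ht ha hb
  rw [← commutatorElement_eq_one_iff_commute]
  refine htf _ ?_ r hr h
  exact commutator_le_self R (commutator_mem_commutator ha hb)

end Torsion

/-! ### Unipotent actions on torsion-free abelian normal subgroups -/

section Unipotent

/-- The binomial expansion of `(x + b) ^ (m + 1)` modulo `x ^ 2`. -/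
theorem exists_add_pow_eq {R : Type*} [Ring R] {x b : R} (h : Commute x b) (m : ℕ) :
    ∃ c : R, (x + b) ^ (m + 1) = b ^ (m + 1) + (m + 1) • (x * b ^ m) + x * x * c := by
  induction m with
  | zero => exact ⟨0, by simp [add_comm]⟩
  | succ m ih =>
    obtain ⟨c, hc⟩ := ih
    refine ⟨(m + 1) • b ^ m + c * (x + b), ?_⟩
    have h1 : b ^ (m + 1) * x = x * b ^ (m + 1) := (h.pow_right _).eq.symm
    have h2 : b ^ m * x = x * b ^ m := (h.pow_right _).eq.symm
    rw [pow_succ, hc]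
    simp only [add_mul, mul_add, smul_mul_assoc, mul_smul_comm, mul_assoc, h1, h2, ← pow_succ]
    rw [succ_nsmul (x * b ^ (m + 1)) (m + 1)]
    abel

/-- If `1 + a`, `1 + b` and their product are unipotent with exponent `k + 2` and commute, then
`a ^ (k + 1) * b ^ (k + 1)` is torsion. -/
theorem smul_pow_mul_pow_eq_zero {R : Type*} [Ring R] {a b : R} (h : Commute a b) (k : ℕ)
    (ha : a ^ (k + 2) = 0) (hb : b ^ (k + 2) = 0)
    (hab : ((1 + a) * (1 + b) - 1) ^ (k + 2) = 0) :
    (k + 2) • (a ^ (k + 1) * b ^ (k + 1)) = 0 := by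
  have hx : Commute (a * (1 + b)) b :=
    h.mul_left ((Commute.one_left b).add_left (Commute.refl b))
  have hc : Commute a (1 + b) := (Commute.one_right a).add_right h
  obtain ⟨c, hc'⟩ := exists_add_pow_eq hx (k + 1)
  have e : (1 + a) * (1 + b) - 1 = a * (1 + b) + b := by
    rw [add_mul, one_mul]; abel
  rw [e, hc', hb, zero_add] at hab
  -- multiply by `a ^ k`, which kills everything of degree at least two in `a`
  have h1 := congrArg (a ^ k * ·) hab
  beta_reduce at h1
  have h2 : a ^ k * (a * (1 + b) * (a * (1 + b)) * c) = 0 := by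
    have h3 : a * (1 + b) * (a * (1 + b)) = a * a * ((1 + b) * (1 + b)) := by
      rw [mul_assoc, ← mul_assoc (1 + b), ← hc.eq]; simp only [mul_assoc]
    rw [h3, mul_assoc, ← mul_assoc (a ^ k), ← mul_assoc (a ^ k), ← pow_succ, ← pow_succ, ha,
      zero_mul]
  have h4 : a ^ k * (a * (1 + b) * b ^ (k + 1)) = a ^ (k + 1) * b ^ (k + 1) := by
    rw [mul_assoc a, ← mul_assoc (a ^ k), ← pow_succ, add_mul, one_mul, ← pow_succ', hb, add_zero]
  rw [mul_zero, mul_add, h2, add_zero, mul_smul_comm, h4] at h1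
  exact h1

universe u

variable {G : Type u} [Group G]

/-- If conjugations by `a` and `b` commute on a torsion-free abelian normal subgroup `V` and
`a`, `b`, `ab` act on `V` unipotently with exponent `k + 2`, then `[V, ₖ₊₁a, ₖ₊₁b] = 1`. -/
theorem engelComm_engelComm_eq_one {V : Subgroup G} (hV : V.Normal)
    (hc : ∀ x ∈ V, ∀ y ∈ V, Commute x y) (htf : TorsionFree V) {a b : G}
    (hab : ∀ v ∈ V, Commute v ⁅a⁻¹, b⁻¹⁆) (k : ℕ)
    (ha : ∀ v ∈ V, engelComm v a (k + 2) = 1) (hb : ∀ v ∈ V, engelComm v b (k + 2) = 1)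
    (h : ∀ v ∈ V, engelComm v (a * b) (k + 2) = 1) :
    ∀ v ∈ V, engelComm (engelComm v a (k + 1)) b (k + 1) = 1 := by
  let _ : CommGroup V :=
    { (inferInstance : Group V) with
      mul_comm := fun x y => Subtype.ext (hc x x.2 y y.2).eq }
  let T : G → AddMonoid.End (Additive V) := fun g =>
    MonoidHom.toAdditive ((MulAut.conjNormal g⁻¹ : MulAut V).toMonoidHom)
  have hT : ∀ g (v : V), (((T g (Additive.ofMul v)).toMul : V) : G) = g⁻¹ * v * g := by
    intro g v
    have := MulAut.conjNormal_apply (H := V) g⁻¹ v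
    rw [inv_inv] at this
    exact this
  have hT1 : ∀ g (v : V) (n : ℕ),
      ((((T g - 1) ^ n) (Additive.ofMul v)).toMul : G) = engelComm (v : G) g n := by
    intro g v n
    induction n with
    | zero => rfl
    | succ n ih =>
      obtain ⟨w, hw⟩ : ∃ w : V, ((T g - 1) ^ n) (Additive.ofMul v) = Additive.ofMul w := ⟨_, rfl⟩
      rw [hw] at ih
      rw [pow_succ']
      change ((((T g - 1) (((T g - 1) ^ n) (Additive.ofMul v))).toMul : V) : G) =
        groupComm (engelComm (v : G) g n) g
      rw [hw, ← ih]
      change (((T g (Additive.ofMul w) - (1 : AddMonoid.End (Additive V)) (Additive.ofMul w)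
          ).toMul : V) : G) = _
      have e : (((T g (Additive.ofMul w) - (1 : AddMonoid.End (Additive V)) (Additive.ofMul w)
          ).toMul : V) : G) = g⁻¹ * w * g * (w : G)⁻¹ := by
        rw [sub_eq_add_neg]
        change (((T g (Additive.ofMul w)).toMul : V) : G) * (w : G)⁻¹ = _
        rw [hT]
      rw [e]
      have h5 := hc _ (hV.conj_mem w w.2 g⁻¹) _ (V.inv_mem w.2)
      rw [inv_inv] at h5
      rw [h5.eq]
      simp [groupComm, mul_assoc]
  have hz : ∀ (g : G) (n : ℕ), (∀ v ∈ V, engelComm v g n = 1) → (T g - 1) ^ n = 0 := by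
    intro g n hg
    ext v
    exact (hT1 g v.toMul n).trans (hg _ v.toMul.2)
  have hmul : ∀ g g' : G, T (g * g') = T g' * T g := by
    intro g g'
    ext v
    change _ = (((T g' (T g v)).toMul : V) : G)
    have h6 := hT g' (T g v).toMul
    have h7 : (((T g v).toMul : V) : G) = g⁻¹ * v.toMul * g := hT g v.toMul
    have h8 := hT (g * g') v.toMul
    refine h8.trans (Eq.trans ?_ h6.symm)
    rw [h7]
    simp [mul_assoc]
  have hcomm : T a * T b = T b * T a := by
    rw [← hmul, ← hmul]
    ext v
    refine (hT (b * a) v.toMul).trans (Eq.trans ?_ (hT (a * b) v.toMul).symm)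
    have h10 : a * b = b * a * ⁅a⁻¹, b⁻¹⁆ := by simp [commutatorElement_def, mul_assoc]
    have h11 := (hab _ (hV.conj_mem _ v.toMul.2 (b * a)⁻¹)).eq
    rw [inv_inv] at h11
    rw [h10]
    generalize (⁅a⁻¹, b⁻¹⁆ : G) = q at h11
    have h12 : (b * a * q)⁻¹ * (v.toMul : G) * (b * a * q) =
        q⁻¹ * ((b * a)⁻¹ * v.toMul * (b * a) * q) := by
      simp [mul_assoc]
    rw [h12, h11, inv_mul_cancel_left]
  have key := smul_pow_mul_pow_eq_zero (a := T b - 1) (b := T a - 1) (R := AddMonoid.End (Additive V))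
    (by
      have : Commute (T b) (T a) := hcomm.symm
      exact (this.sub_left (Commute.one_left _)).sub_right
        ((Commute.one_right _).sub_left (Commute.one_right _))) k (hz b _ hb) (hz a _ ha)
    (by rw [add_sub_cancel, add_sub_cancel, ← hmul]; exact hz _ _ h)
  intro v hv
  refine htf _ (engelComm_mem hV (engelComm_mem hV hv _ _) _ _) (k + 2) (by omega) ?_
  have h13 := DFunLike.congr_fun key (Additive.ofMul (⟨v, hv⟩ : V))
  obtain ⟨w, hw⟩ : ∃ w : V, ((T a - 1) ^ (k + 1)) (Additive.ofMul (⟨v, hv⟩ : V)) =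
    Additive.ofMul w := ⟨_, rfl⟩
  have hw' : engelComm v a (k + 1) = w := by
    rw [← hT1 a ⟨v, hv⟩ (k + 1), hw]; rfl
  rw [hw', ← hT1 b w (k + 1), ← hw]
  exact congrArg (fun z : Additive V => ((z.toMul : V) : G)) h13

/-- An element acting unipotently on a torsion-free normal subgroup acts trivially if one of its
powers does. -/
theorem commute_of_pow_commute {V : Subgroup G} (hV : V.Normal)
    (htf : TorsionFree V) {g : G} {l : ℕ} (hl : 0 < l)
    (hg : ∀ v ∈ V, Commute v (g ^ l)) (n : ℕ) (hn : ∀ v ∈ V, engelComm v g (n + 1) = 1) :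
    ∀ v ∈ V, Commute v g := by
  induction n with
  | zero => exact fun v hv => groupComm_eq_one_iff.1 (hn v hv)
  | succ n ih =>
    refine ih fun v hv => ?_
    obtain ⟨w, hw, hwV⟩ : ∃ w, w = engelComm v g n ∧ w ∈ V := ⟨_, rfl, engelComm_mem hV hv g n⟩
    have h1 : Commute (groupComm w g) g := by
      rw [hw]; exact groupComm_eq_one_iff.1 (hn v hv)
    change groupComm (engelComm v g n) g = 1
    rw [← hw]
    refine htf _ (groupComm_mem_left hV hwV g) l hl ?_
    -- `g⁻ʲ w gʲ = w [w, g]ʲ`, as `[w, g]` commutes with `g`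
    have h2 : ∀ j : ℕ, (g ^ j)⁻¹ * w * g ^ j = w * groupComm w g ^ j := by
      intro j
      induction j with
      | zero => simp
      | succ j ihj =>
        have e : (g ^ (j + 1))⁻¹ * w * g ^ (j + 1) = g⁻¹ * ((g ^ j)⁻¹ * w * g ^ j) * g := by
          simp [pow_succ, mul_assoc]
        have h3 := (h1.pow_left j).eq
        rw [e, ihj, mul_assoc, mul_assoc, h3, pow_succ']
        simp [groupComm, mul_assoc]
    have h4 := h2 l
    rw [mul_assoc, (hg w hwV).eq, inv_mul_cancel_left] at h4
    exact (left_eq_mul.1 h4)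

/-- The elements of an abelian normal subgroup that are killed by `[·, ₙb]` for all `b ∈ B`. -/
def engelKernel {V B : Subgroup G} (hV : V.Normal) (hc : ∀ x ∈ V, ∀ y ∈ V, Commute x y)
    (n : ℕ) : Subgroup G where
  carrier := {v | v ∈ V ∧ ∀ b ∈ B, engelComm v b n = 1}
  one_mem' := ⟨V.one_mem, fun b _ => engelComm_one_left b n⟩
  mul_mem' := fun {x y} hx hy => ⟨V.mul_mem hx.1 hy.1, fun b hb => by
    rw [engelComm_mul_of_commute hV hc hx.1 hy.1, hx.2 b hb, hy.2 b hb, one_mul]⟩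
  inv_mem' := fun {x} hx => ⟨V.inv_mem hx.1, fun b hb => by
    rw [engelComm_inv_of_commute hV hc hx.1, hx.2 b hb, inv_one]⟩

theorem engelKernel_normal {V B : Subgroup G} (hV : V.Normal) (hB : B.Normal)
    (hc : ∀ x ∈ V, ∀ y ∈ V, Commute x y) (n : ℕ) :
    (engelKernel (B := B) hV hc n).Normal := by
  refine ⟨fun v hv g => ⟨hV.conj_mem v hv.1 g, fun b hb => ?_⟩⟩
  have h := map_engelComm (MulAut.conj g).toMonoidHom v (g⁻¹ * b * g) n
  have hb' : g⁻¹ * b * g ∈ B := by simpa using hB.conj_mem b hb g⁻¹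
  rw [hv.2 _ hb', map_one] at h
  simpa [mul_assoc] using h.symm

/-- The quotient of `V` by an `engelKernel` is torsion-free, as the latter is an intersection of
kernels of endomorphisms of the torsion-free group `V`. -/
theorem torsionFree_map_engelKernel {V B : Subgroup G} (hV : V.Normal)
    (hc : ∀ x ∈ V, ∀ y ∈ V, Commute x y) (htf : TorsionFree V) (n : ℕ)
    [(engelKernel (B := B) hV hc n).Normal] :
    TorsionFree (V.map (QuotientGroup.mk' (engelKernel (B := B) hV hc n))) := by
  rintro _ ⟨v, hv, rfl⟩ l hl h
  rw [← map_pow] at h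
  have h1 := (QuotientGroup.eq_one_iff _).1 h
  refine (QuotientGroup.eq_one_iff _).2 ⟨hv, fun b hb => ?_⟩
  refine htf _ (engelComm_mem hV hv b n) l hl ?_
  rw [← engelComm_pow_of_commute hV hc hv]
  exact h1.2 b hb

end Unipotent

section Nilpotent

universe u

theorem commute_map {G H : Type*} [Group G] [Group H] (f : G →* H) {V W : Subgroup G}
    (hc : ∀ x ∈ V, ∀ y ∈ W, Commute x y) : ∀ x ∈ V.map f, ∀ y ∈ W.map f, Commute x y := by
  rintro _ ⟨x, hx, rfl⟩ _ ⟨y, hy, rfl⟩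
  exact (hc x hx y hy).map f

theorem engelComm_map_eq_one {G H : Type*} [Group G] [Group H] (f : G →* H) {V B : Subgroup G}
    {n : ℕ} (h : ∀ v ∈ V, ∀ b ∈ B, f (engelComm v b n) = 1) :
    ∀ v ∈ V.map f, ∀ b ∈ B.map f, engelComm v b n = 1 := by
  rintro _ ⟨x, hx, rfl⟩ _ ⟨y, hy, rfl⟩
  rw [← map_engelComm, h x hx y hy]

/-- A group acting by pairwise commuting unipotent automorphisms of bounded exponent on a
torsion-free abelian group acts nilpotently.  The induction on the exponent uses the submodule
`W` of the elements killed by all `[·, ₙb]`. -/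
theorem exists_iterComm_eq_bot_of_abelian (n : ℕ) : ∀ (G : Type u) [Group G] (V B : Subgroup G),
    V.Normal → B.Normal → (∀ x ∈ V, ∀ y ∈ V, Commute x y) → TorsionFree V →
    (∀ v ∈ V, ∀ b ∈ ⁅B, B⁆, Commute v b) → (∀ v ∈ V, ∀ b ∈ B, engelComm v b (n + 1) = 1) →
    ∃ t, iterComm V B t = ⊥ := by
  induction n with
  | zero =>
    intro G _ V B _ _ _ _ _ h
    exact ⟨1, commutator_eq_bot_of_commute fun v hv b hb => groupComm_eq_one_iff.1 (h v hv b hb)⟩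
  | succ n ih =>
    intro G _ V B hV hB hc htf hBB h
    let W := engelKernel (B := B) hV hc (n + 1)
    have hW : W.Normal := engelKernel_normal hV hB hc (n + 1)
    have hWV : W ≤ V := fun w hw => hw.1
    obtain ⟨t1, h1⟩ := ih (G ⧸ W) (V.map (QuotientGroup.mk' W)) (B.map (QuotientGroup.mk' W))
      (hV.map _ (QuotientGroup.mk'_surjective W)) (hB.map _ (QuotientGroup.mk'_surjective W))
      (commute_map _ hc) (torsionFree_map_engelKernel hV hc htf (n + 1))
      (by rw [← map_commutator]; exact commute_map _ hBB)
      (engelComm_map_eq_one _ fun v hv a ha => (QuotientGroup.eq_one_iff _).2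
        ⟨engelComm_mem hV hv a _, fun b hb => engelComm_engelComm_eq_one hV hc htf
          (fun v hv => hBB v hv _ (commutator_mem_commutator (B.inv_mem ha) (B.inv_mem hb))) n
          (fun v hv => h v hv a ha) (fun v hv => h v hv b hb)
          (fun v hv => h v hv _ (B.mul_mem ha hb)) v hv⟩)
    obtain ⟨t2, h2⟩ := ih G W B hW hB (fun x hx y hy => hc x (hWV hx) y (hWV hy))
      (fun x hx => htf x (hWV hx)) (fun v hv => hBB v (hWV hv)) (fun v hv => hv.2)
    exact ⟨t1 + t2, iterComm_eq_bot_of_quotient h1 h2⟩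

/-- A group acting unipotently with bounded exponent on a torsion-free abelian normal subgroup acts
nilpotently, if it is soluble-by-finite modulo the centralizer.  Here `E` is a multiple of the
exponent of the finite quotient. -/
theorem exists_iterComm_top_eq_bot (n E : ℕ) (hE : 0 < E) (d : ℕ) :
    ∀ (G : Type u) [Group G] (V N : Subgroup G),
    V.Normal → N.Normal → (∀ g : G, g ^ E ∈ N) → (∀ x ∈ V, ∀ y ∈ V, Commute x y) →
    TorsionFree V → (∀ v ∈ V, ∀ b ∈ derIter N d, Commute v b) →
    (∀ v ∈ V, ∀ g : G, engelComm v g (n + 1) = 1) → ∃ t, iterComm V ⊤ t = ⊥ := by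
  induction d with
  | zero =>
    intro G _ V N hV _ hNE _ htf hN h
    refine ⟨1, commutator_eq_bot_of_commute fun v hv g _ => ?_⟩
    exact commute_of_pow_commute hV htf hE (fun v hv => hN v hv _ (hNE g)) n
      (fun v hv => h v hv g) v hv
  | succ d ih =>
    have inner : ∀ (t : ℕ) (G : Type u) [Group G] (V N : Subgroup G),
        V.Normal → N.Normal → (∀ g : G, g ^ E ∈ N) → (∀ x ∈ V, ∀ y ∈ V, Commute x y) →
        TorsionFree V → iterComm V (derIter N d) t = ⊥ →
        (∀ v ∈ V, ∀ g : G, engelComm v g (n + 1) = 1) → ∃ t, iterComm V ⊤ t = ⊥ := by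
      intro t
      induction t with
      | zero => intro G _ V N _ _ _ _ _ h _; exact ⟨0, h⟩
      | succ t iht =>
        intro G _ V N hV hN hNE hc htf ht h
        have hB := derIter_normal hN d
        let C := engelKernel (B := derIter N d) hV hc 1
        have hC : C.Normal := engelKernel_normal hV hB hc 1
        have hCV : C ≤ V := fun w hw => hw.1
        have hsurj := QuotientGroup.mk'_surjective C
        obtain ⟨t1, h1⟩ := iht (G ⧸ C) (V.map (QuotientGroup.mk' C)) (N.map (QuotientGroup.mk' C))
          (hV.map _ hsurj) (hN.map _ hsurj)
          (fun g => by
            obtain ⟨g, rfl⟩ := hsurj g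
            rw [← map_pow]
            exact mem_map_of_mem _ (hNE g))
          (commute_map _ hc) (torsionFree_map_engelKernel hV hc htf 1)
          (by
            rw [← map_derIter, ← map_iterComm, map_mk_eq_bot_iff]
            intro v hv
            have hvV : v ∈ V := by
              have hle : ∀ s, iterComm V (derIter N d) s ≤ V := by
                intro s
                induction s with
                | zero => exact le_rfl
                | succ s ihs => exact (commutator_mono ihs le_rfl).trans (commutator_le_left _ _)
              exact hle t hv
            refine ⟨hvV, fun b hb => groupComm_eq_one_iff.2 ?_⟩
            exact commute_of_commutator_eq_bot ht hv hb)
          (fun v hv g => engelComm_map_eq_one (B := ⊤) (QuotientGroup.mk' C)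
            (fun v hv b _ => by rw [h v hv b, map_one]) v hv g (by
              rw [map_top_of_surjective _ hsurj]; trivial))
        obtain ⟨t2, h2⟩ := ih G C N hC hN hNE (fun x hx y hy => hc x (hCV hx) y (hCV hy))
          (fun x hx => htf x (hCV hx))
          (fun v hv b hb => groupComm_eq_one_iff.1 (hv.2 b hb)) (fun v hv => h v (hCV hv))
        refine ⟨t1 + t2, iterComm_eq_bot_of_quotient ?_ h2⟩
        rw [map_top_of_surjective _ hsurj]
        exact h1
    intro G _ V N hV hN hNE hc htf hd h
    obtain ⟨t, ht⟩ := exists_iterComm_eq_bot_of_abelian n G V (derIter N d) hV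
      (derIter_normal hN d) hc htf hd (fun v hv b _ => h v hv b)
    exact inner t G V N hV hN hNE hc htf ht h

/-- A soluble-by-finite group acting unipotently with bounded exponent on a torsion-free abelian
normal subgroup acts nilpotently. -/
theorem VirtSol.exists_iterComm_eq_bot {G : Type u} [Group G] (hG : VirtSol G) {V : Subgroup G}
    (hV : V.Normal) (hc : ∀ x ∈ V, ∀ y ∈ V, Commute x y) (htf : TorsionFree V) {n : ℕ}
    (hn : 0 < n) (h : ∀ v ∈ V, ∀ g : G, engelComm v g n = 1) : ∃ t, iterComm V ⊤ t = ⊥ := by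
  obtain ⟨N, hN, hi, s, hs⟩ := hG
  obtain ⟨n, rfl⟩ := Nat.exists_eq_succ_of_ne_zero hn.ne'
  refine exists_iterComm_top_eq_bot n N.index (Nat.pos_of_ne_zero hi.index_ne_zero) s G V N hV hN
    (fun g => N.pow_index_mem g) hc htf (fun v _ b hb => ?_) h
  rw [hs, mem_bot] at hb
  rw [hb]
  exact Commute.one_right v

end Nilpotent

/-! ### Multilinear commutators evaluated at elements and at normal subgroups -/

/-- The bracketing of an iterated commutator with leaves labelled by variables. -/
inductive CommTree (α : Type*) where
  | leaf : α → CommTree α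
  | node : CommTree α → CommTree α → CommTree α

namespace CommTree

variable {α : Type*} {G H : Type*} [Group G] [Group H]

/-- The variables that occur in the tree. -/
def vars : CommTree α → Set α
  | leaf i => {i}
  | node l r => l.vars ∪ r.vars

/-- Every variable labels at most one leaf. -/
def Multilinear : CommTree α → Prop
  | leaf _ => True
  | node l r => l.Multilinear ∧ r.Multilinear ∧ Disjoint l.vars r.vars

/-- The value of the commutator at the elements `g i`. -/
def eval (g : α → G) : CommTree α → G
  | leaf i => g i
  | node l r => groupComm (l.eval g) (r.eval g)

/-- The commutator of the subgroups `P i`, with the same bracketing. -/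
def sub (P : α → Subgroup G) : CommTree α → Subgroup G
  | leaf i => P i
  | node l r => ⁅l.sub P, r.sub P⁆

/-- The product of the commutators of subgroups that arise from `sub P` when one of the entries
`P i` is replaced by `⁅P i, B⁆`, as in the Leibniz rule. -/
def der (P : α → Subgroup G) (B : Subgroup G) : CommTree α → Subgroup G
  | leaf i => ⁅P i, B⁆
  | node l r => ⁅l.der P B, r.sub P⁆ ⊔ ⁅l.sub P, r.der P B⁆

theorem vars_nonempty (t : CommTree α) : t.vars.Nonempty := by
  induction t with
  | leaf i => exact ⟨i, rfl⟩
  | node l r ihl _ => exact ihl.inl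

theorem exists_of_multilinearCommOn {w : FreeGroup α} {S : Set α} (h : MultilinearCommOn w S) :
    ∃ t : CommTree α, t.Multilinear ∧ t.vars = S ∧ t.eval FreeGroup.of = w := by
  induction h with
  | var i => exact ⟨leaf i, trivial, rfl, rfl⟩
  | comm _ _ hd ihu ihv =>
    obtain ⟨l, hl, rfl, rfl⟩ := ihu
    obtain ⟨r, hr, rfl, rfl⟩ := ihv
    exact ⟨node l r, ⟨hl, hr, hd⟩, rfl, rfl⟩

theorem map_eval (f : G →* H) (g : α → G) (t : CommTree α) :
    f (t.eval g) = t.eval (fun i => f (g i)) := by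
  induction t with
  | leaf i => rfl
  | node l r ihl ihr => simp only [eval, map_groupComm, ihl, ihr]

theorem eval_congr {g g' : α → G} {t : CommTree α} (h : ∀ i ∈ t.vars, g i = g' i) :
    t.eval g = t.eval g' := by
  induction t with
  | leaf i => exact h i rfl
  | node l r ihl ihr =>
    simp only [eval]
    rw [ihl fun i hi => h i (Or.inl hi), ihr fun i hi => h i (Or.inr hi)]

theorem sub_congr {P P' : α → Subgroup G} {t : CommTree α} (h : ∀ i ∈ t.vars, P i = P' i) :
    t.sub P = t.sub P' := by
  induction t with
  | leaf i => exact h i rfl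
  | node l r ihl ihr =>
    simp only [sub]
    rw [ihl fun i hi => h i (Or.inl hi), ihr fun i hi => h i (Or.inr hi)]

theorem sub_mono {P P' : α → Subgroup G} (h : ∀ i, P i ≤ P' i) (t : CommTree α) :
    t.sub P ≤ t.sub P' := by
  induction t with
  | leaf i => exact h i
  | node l r ihl ihr => exact commutator_mono ihl ihr

theorem sub_normal {P : α → Subgroup G} (hP : ∀ i, (P i).Normal) (t : CommTree α) :
    (t.sub P).Normal := by
  induction t with
  | leaf i => exact hP i
  | node l r ihl ihr => simp only [sub]; infer_instance

theorem der_normal {P : α → Subgroup G} (hP : ∀ i, (P i).Normal) {B : Subgroup G}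
    (hB : B.Normal) (t : CommTree α) : (t.der P B).Normal := by
  induction t with
  | leaf i => have := hP i; simp only [der]; infer_instance
  | node l r ihl ihr =>
    have := sub_normal hP l
    have := sub_normal hP r
    simp only [der]; infer_instance

theorem sub_le {P : α → Subgroup G} (hP : ∀ i, (P i).Normal) {t : CommTree α} {i : α}
    (hi : i ∈ t.vars) : t.sub P ≤ P i := by
  induction t with
  | leaf j => rw [Set.mem_singleton_iff.1 hi]; exact le_rfl
  | node l r ihl ihr =>
    have := sub_normal hP l
    have := sub_normal hP r
    rcases hi with hi | hi
    · exact (commutator_le_left _ _).trans (ihl hi)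
    · exact (commutator_le_right _ _).trans (ihr hi)

theorem eval_mem_sub {P : α → Subgroup G} {g : α → G} (hg : ∀ i, g i ∈ P i) (t : CommTree α) :
    t.eval g ∈ t.sub P := by
  induction t with
  | leaf i => exact hg i
  | node l r ihl ihr => exact groupComm_mem ihl ihr

theorem closure_eval_normal {P : α → Subgroup G} (hP : ∀ i, (P i).Normal) (t : CommTree α) :
    (closure {x | ∃ g : α → G, (∀ i, g i ∈ P i) ∧ t.eval g = x}).Normal := by
  refine ⟨fun x hx c => ?_⟩
  have h := mem_map_of_mem (MulAut.conj c).toMonoidHom hx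
  rw [MonoidHom.map_closure] at h
  refine closure_mono ?_ h
  rintro _ ⟨_, ⟨g, hg, rfl⟩, rfl⟩
  exact ⟨_, fun i => (hP i).conj_mem _ (hg i) c, (map_eval (MulAut.conj c).toMonoidHom g t).symm⟩

/-- A multilinear commutator of normal subgroups is generated by the values of the commutator. -/
theorem sub_eq_closure {P : α → Subgroup G} (hP : ∀ i, (P i).Normal) {t : CommTree α}
    (ht : t.Multilinear) :
    t.sub P = closure {x | ∃ g : α → G, (∀ i, g i ∈ P i) ∧ t.eval g = x} := by
  refine le_antisymm ?_ (by rw [closure_le]; rintro _ ⟨g, hg, rfl⟩; exact eval_mem_sub hg t)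
  induction t with
  | leaf i =>
    classical
    intro x hx
    refine subset_closure ⟨fun j => if j = i then x else 1, fun j => ?_, if_pos rfl⟩
    dsimp only
    split_ifs with h
    · rwa [h]
    · exact one_mem _
  | node l r ihl ihr =>
    have hN := closure_eval_normal hP (node l r)
    refine (commutator_mono (ihl ht.1) (ihr ht.2.1)).trans (closure_commutator_closure_le ?_)
    rintro _ ⟨g, hg, rfl⟩ _ ⟨g', hg', rfl⟩
    classical
    have hmem : groupComm (l.eval g) (r.eval g') ∈
        closure {x | ∃ g : α → G, (∀ i, g i ∈ P i) ∧ (node l r).eval g = x} := by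
      refine subset_closure ⟨fun i => if i ∈ l.vars then g i else g' i, fun i => ?_, ?_⟩
      · dsimp only
        split_ifs
        exacts [hg i, hg' i]
      · simp only [eval]
        congr 1
        · exact eval_congr fun i hi => if_pos hi
        · exact eval_congr fun i hi => if_neg fun h => Set.disjoint_left.1 ht.2.2 h hi
    rw [← QuotientGroup.eq_one_iff] at hmem ⊢
    have e1 := map_groupComm (QuotientGroup.mk' (closure {x | ∃ g : α → G, (∀ i, g i ∈ P i) ∧
      (node l r).eval g = x})) (l.eval g) (r.eval g')
    have e2 := map_commutatorElement (QuotientGroup.mk' (closure {x | ∃ g : α → G,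
      (∀ i, g i ∈ P i) ∧ (node l r).eval g = x})) (l.eval g) (r.eval g')
    refine e2.trans ?_
    rw [commutatorElement_eq_one_iff_commute, ← groupComm_eq_one_iff]
    exact e1.symm.trans hmem

/-- The Leibniz rule, from the three subgroups lemma. -/
theorem sub_commutator_le_der {P : α → Subgroup G} (hP : ∀ i, (P i).Normal) {B : Subgroup G}
    (hB : B.Normal) (t : CommTree α) : ⁅t.sub P, B⁆ ≤ t.der P B := by
  induction t with
  | leaf i => exact le_rfl
  | node l r ihl ihr =>
    have := der_normal hP hB (node l r)
    refine three_subgroups_le ?_ ?_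
    · exact (commutator_mono ihl le_rfl).trans le_sup_left
    · exact (commutator_mono le_rfl ihr).trans le_sup_right

variable [DecidableEq α]

theorem der_le_iSup {P : α → Subgroup G} (hP : ∀ i, (P i).Normal) {B : Subgroup G}
    (hB : B.Normal) {t : CommTree α} (ht : t.Multilinear) :
    t.der P B ≤ ⨆ j : t.vars, t.sub (Function.update P j ⁅P j, B⁆) := by
  have hN : ∀ (s : CommTree α) (j : α), (s.sub (Function.update P j ⁅P j, B⁆)).Normal := by
    intro s j
    refine sub_normal (fun i => ?_) s
    have := hP j
    rcases eq_or_ne i j with rfl | h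
    · rw [Function.update_self]; infer_instance
    · rw [Function.update_of_ne h]; exact hP i
  have hS : ∀ s : CommTree α, (⨆ j : s.vars, s.sub (Function.update P j ⁅P j, B⁆)).Normal :=
    fun s => by
      have : ∀ j : s.vars, (s.sub (Function.update P j ⁅P j, B⁆)).Normal := fun j => hN s j
      exact iSup_normal _
  induction t with
  | leaf i =>
    refine le_trans ?_ (le_iSup _ (⟨i, rfl⟩ : (leaf i).vars))
    simp [der, sub]
  | node l r ihl ihr =>
    have := hS (node l r)
    refine sup_le ?_ ?_
    · refine (commutator_mono (ihl ht.1) le_rfl).trans (iSup_commutator_le fun j => ?_)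
      refine le_trans (le_of_eq ?_) (le_iSup _ (⟨j, Or.inl j.2⟩ : (node l r).vars))
      simp only [sub]
      congr 1
      refine sub_congr fun i hi => ?_
      rw [Function.update_of_ne]
      rintro rfl
      exact Set.disjoint_left.1 ht.2.2 j.2 hi
    · rw [commutator_comm]
      refine (commutator_mono (ihr ht.2.1) le_rfl).trans (iSup_commutator_le fun j => ?_)
      refine le_trans (le_of_eq ?_) (le_iSup _ (⟨j, Or.inr j.2⟩ : (node l r).vars))
      simp only [sub]
      rw [commutator_comm]
      congr 1
      refine sub_congr fun i hi => ?_
      rw [Function.update_of_ne]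
      rintro rfl
      exact Set.disjoint_left.1 ht.2.2 hi j.2

theorem groupComm_mul_left_of_commute {e x y z : G} (h : Commute e z)
    (h' : Commute y (groupComm x z)) :
    groupComm (e * (x * y)) z = groupComm x z * groupComm y z := by
  have h1 : e⁻¹ * z⁻¹ * e = z⁻¹ := by
    rw [h.inv_inv.eq, mul_assoc, inv_mul_cancel, mul_one]
  have h2 : groupComm (e * (x * y)) z = y⁻¹ * (x⁻¹ * (e⁻¹ * z⁻¹ * e) * x * y * z) := by
    simp [groupComm, mul_assoc]
  have h3 : groupComm x z * groupComm y z = y⁻¹ * (y * groupComm x z) * groupComm y z := by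
    simp
  rw [h2, h1, h3, h'.eq]
  simp [groupComm, mul_assoc]

theorem groupComm_mul_right_of_commute {e x y z : G} (h : Commute e z)
    (h1 : Commute (groupComm z x) y) (h2 : Commute (groupComm z x) (groupComm z y)) :
    groupComm z (e * (x * y)) = groupComm z x * groupComm z y := by
  have h3 : e⁻¹ * z * e = z := by
    rw [h.inv_left.eq, mul_assoc, inv_mul_cancel, mul_one]
  have h4 : groupComm z (e * (x * y)) = z⁻¹ * y⁻¹ * x⁻¹ * (e⁻¹ * z * e) * x * y := by
    simp [groupComm, mul_assoc]
  have h5 : z⁻¹ * y⁻¹ * x⁻¹ * z * x * y = groupComm z y * (y⁻¹ * groupComm z x * y) := by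
    simp [groupComm, mul_assoc]
  rw [h4, h3, h5, mul_assoc y⁻¹, h1.eq, inv_mul_cancel_left, h2.eq]

/-- A multilinear commutator is multiplicative in the variable `i` modulo `der t P (P i)`. -/
theorem eval_update_mul {P : α → Subgroup G} (hP : ∀ i, (P i).Normal) {t : CommTree α}
    (ht : t.Multilinear) {i : α} (hi : i ∈ t.vars) {g : α → G} (hg : ∀ j, g j ∈ P j) {a b : G}
    (ha : a ∈ P i) (hb : b ∈ P i) :
    t.eval (Function.update g i (a * b)) *
      (t.eval (Function.update g i a) * t.eval (Function.update g i b))⁻¹ ∈ t.der P (P i) := by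
  have hupd : ∀ c ∈ P i, ∀ j, Function.update g i c j ∈ P j := by
    intro c hc j
    rcases eq_or_ne j i with rfl | h
    · rwa [Function.update_self]
    · rw [Function.update_of_ne h]; exact hg j
  induction t with
  | leaf j =>
    rw [Set.mem_singleton_iff.1 hi]
    simp [eval]
  | node l r ihl ihr =>
    have hE := der_normal hP (hP i) (node l r)
    let π := QuotientGroup.mk' ((node l r).der P (P i))
    have hco : ∀ {x y : G}, ⁅x, y⁆ ∈ (node l r).der P (P i) → Commute (π x) (π y) := by
      intro x y h
      rw [← commutatorElement_eq_one_iff_commute, ← map_commutatorElement]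
      exact (QuotientGroup.eq_one_iff _).2 h
    have hder := sub_commutator_le_der hP (hP i) (node l r)
    have hgoal : ∀ {x y z : G}, π x = π y * π z → x * (y * z)⁻¹ ∈ (node l r).der P (P i) := by
      intro x y z h
      refine (QuotientGroup.eq_one_iff _).1 ?_
      change π (x * (y * z)⁻¹) = 1
      rw [map_mul, map_inv, map_mul, h, mul_inv_cancel]
    have hab := P i |>.mul_mem ha hb
    apply hgoal
    simp only [eval, map_groupComm]
    rcases hi with hi | hi
    · have hr : ∀ c, r.eval (Function.update g i c) = r.eval g := fun c =>
        eval_congr fun j hj => Function.update_of_ne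
          (by rintro rfl; exact Set.disjoint_left.1 ht.2.2 hi hj) _ _
      rw [hr, hr, hr]
      obtain ⟨e, he, h1⟩ : ∃ e ∈ l.der P (P i), l.eval (Function.update g i (a * b)) =
          e * (l.eval (Function.update g i a) * l.eval (Function.update g i b)) :=
        ⟨_, ihl ht.1 hi, (inv_mul_cancel_right _ _).symm⟩
      rw [h1, map_mul, map_mul]
      refine groupComm_mul_left_of_commute (hco ?_) ?_
      · exact le_sup_left (a := ⁅l.der P (P i), r.sub P⁆)
          (commutator_mem_commutator he (eval_mem_sub hg r))
      · rw [← map_groupComm]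
        refine (hco (hder (commutator_mem_commutator ?_ ?_))).symm
        · exact groupComm_mem (eval_mem_sub (hupd a ha) l) (eval_mem_sub hg r)
        · exact sub_le hP hi (eval_mem_sub (hupd b hb) l)
    · have hl : ∀ c, l.eval (Function.update g i c) = l.eval g := fun c =>
        eval_congr fun j hj => Function.update_of_ne
          (by rintro rfl; exact Set.disjoint_left.1 ht.2.2 hj hi) _ _
      rw [hl, hl, hl]
      obtain ⟨e, he, h1⟩ : ∃ e ∈ r.der P (P i), r.eval (Function.update g i (a * b)) =
          e * (r.eval (Function.update g i a) * r.eval (Function.update g i b)) :=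
        ⟨_, ihr ht.2.1 hi, (inv_mul_cancel_right _ _).symm⟩
      rw [h1, map_mul, map_mul]
      have hB : ∀ c ∈ P i, r.eval (Function.update g i c) ∈ P i := fun c hc =>
        sub_le hP hi (eval_mem_sub (hupd c hc) r)
      have hmem : ∀ c ∈ P i, groupComm (l.eval g) (r.eval (Function.update g i c)) ∈
          (node l r).sub P := fun c hc =>
        groupComm_mem (eval_mem_sub hg l) (eval_mem_sub (hupd c hc) r)
      refine groupComm_mul_right_of_commute (hco ?_).symm ?_ ?_
      · exact le_sup_right (a := ⁅l.der P (P i), r.sub P⁆)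
          (commutator_mem_commutator (eval_mem_sub hg l) he)
      · rw [← map_groupComm]
        exact hco (hder (commutator_mem_commutator (hmem a ha) (hB b hb)))
      · rw [← map_groupComm, ← map_groupComm]
        exact hco (hder (commutator_mem_commutator (hmem a ha)
          (sub_le hP (t := node l r) (Or.inr hi) (hmem b hb))))

end CommTree

/-! ### Normal series with unipotent or torsion factors -/

section TameStep

universe u

variable {G : Type*} [Group G]

/-- A step `E ≤ K` of normal subgroups whose factor `K / E` is torsion, or is abelian and modulo
torsion satisfies `[x, ₙy] = 1` for all `x` in it and all `y` in the group. -/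
def TameStep (n : ℕ) (E K : Subgroup G) : Prop :=
  E.Normal ∧ K.Normal ∧ E ≤ K ∧
    (TorsionMod E K ∨ (⁅K, K⁆ ≤ E ∧ ∀ x ∈ K, ∀ y, ∃ l : ℕ, 0 < l ∧ engelComm x y n ^ l ∈ E))

theorem TameStep.sup {n : ℕ} {E K M : Subgroup G} (h : TameStep n E K) (hM : M.Normal) :
    TameStep n (E ⊔ M) (K ⊔ M) := by
  obtain ⟨hE, hK, hEK, h⟩ := h
  have hmod : ∀ x ∈ K ⊔ M, ∃ k ∈ K, (x : G ⧸ (E ⊔ M)) = k := by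
    intro x hx
    rw [← SetLike.mem_coe, mul_normal, Set.mem_mul] at hx
    obtain ⟨k, hk, m, hm, rfl⟩ := hx
    refine ⟨k, hk, ?_⟩
    have : (m : G ⧸ (E ⊔ M)) = 1 := (QuotientGroup.eq_one_iff m).2 (le_sup_right (a := E) hm)
    rw [QuotientGroup.mk_mul, this, mul_one]
  refine ⟨inferInstance, inferInstance, sup_le_sup_right hEK M, ?_⟩
  rcases h with h | ⟨hc, h⟩
  · left
    intro x hx
    obtain ⟨k, hk, e⟩ := hmod x hx
    obtain ⟨l, hl, hkl⟩ := h k hk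
    refine ⟨l, hl, ?_⟩
    rw [← QuotientGroup.eq_one_iff, QuotientGroup.mk_pow, e, ← QuotientGroup.mk_pow,
      QuotientGroup.eq_one_iff]
    exact le_sup_left (a := E) hkl
  · right
    refine ⟨sup_commutator_le (commutator_sup_le (hc.trans le_sup_left) ?_) ?_, ?_⟩
    · exact (commutator_le_right _ _).trans le_sup_right
    · exact (commutator_le_left _ _).trans le_sup_right
    · intro x hx y
      obtain ⟨k, hk, e⟩ := hmod x hx
      obtain ⟨l, hl, hkl⟩ := h k hk y
      refine ⟨l, hl, ?_⟩
      have e2 := map_engelComm (QuotientGroup.mk' (E ⊔ M)) x y n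
      have e3 := map_engelComm (QuotientGroup.mk' (E ⊔ M)) k y n
      have e4 : QuotientGroup.mk' (E ⊔ M) x = QuotientGroup.mk' (E ⊔ M) k := e
      rw [e4, ← e3] at e2
      rw [← QuotientGroup.eq_one_iff]
      change QuotientGroup.mk' (E ⊔ M) _ = 1
      rw [map_pow, e2, ← map_pow]
      exact (QuotientGroup.eq_one_iff _).2 (le_sup_left (a := E) hkl)

/-- `K` is reached from `F` by finitely many tame steps. -/
def TameChain (n : ℕ) (F K : Subgroup G) : Prop :=
  ReflTransGen (TameStep n) F K

theorem TameChain.sup {n : ℕ} {F K M : Subgroup G} (h : TameChain n F K) (hM : M.Normal) :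
    TameChain n (F ⊔ M) (K ⊔ M) :=
  ReflTransGen.lift (· ⊔ M) (fun _ _ hs => hs.sup hM) _ _ h

theorem TameChain.finset_sup {ι : Type*} {n : ℕ} {F : Subgroup G} (f : ι → Subgroup G)
    (hf : ∀ i, (f i).Normal) (s : Finset ι) (h : ∀ i ∈ s, TameChain n F (F ⊔ f i)) :
    TameChain n F (F ⊔ s.sup f) := by
  classical
  induction s using Finset.induction_on with
  | empty =>
    rw [Finset.sup_empty, sup_bot_eq]
    exact ReflTransGen.refl
  | insert i s his ih =>
    have h1 := ih fun j hj => h j (Finset.mem_insert_of_mem hj)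
    have h2 := h1.sup (hf i)
    rw [Finset.sup_insert, sup_comm (f i), ← sup_assoc]
    exact (h i (Finset.mem_insert_self i s)).trans h2

/-- A soluble-by-finite group without normal torsion acts nilpotently on every normal subgroup `X`
with a tame chain, and `X` is torsion-free. The statement is about quotients `Q` of `G`, as the
induction on the chain passes to the quotient by the largest normal subgroup that is torsion modulo
the lowest factor. -/
theorem TameChain.torsionFree_and_exists_iterComm {G : Type u} [Group G] (hG : VirtSol G) {n : ℕ}
    (hn : 0 < n) {E X : Subgroup G} (h : TameChain n E X) :
    ∀ (Q : Type u) [Group Q] (π : G →* Q), Function.Surjective π → E ≤ π.ker →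
      NoTorsionNormal Q → TorsionFree (X.map π) ∧ ∃ t, iterComm (X.map π) ⊤ t = ⊥ := by
  induction h using ReflTransGen.head_induction_on with
  | refl =>
    intro Q _ π _ hE _
    rw [(Subgroup.map_eq_bot_iff _).2 hE]
    exact ⟨fun x hx _ _ _ => hx, 0, rfl⟩
  | @head E K hstep _ ih =>
    intro Q _ π hπ hE hQ
    obtain ⟨-, hK, -, hstep⟩ := hstep
    have hQV : VirtSol Q := hG.of_surjective π hπ
    have hA : (K.map π).Normal := hK.map π hπ
    rcases hstep with ht | ⟨hc, hu⟩
    · refine ih Q π hπ ?_ hQ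
      rw [← Subgroup.map_eq_bot_iff]
      refine hQ _ hA ?_
      rintro _ ⟨x, hx, rfl⟩
      obtain ⟨l, hl, hxl⟩ := ht x hx
      exact ⟨l, hl, by rw [← map_pow]; exact mem_bot.2 (hE hxl)⟩
    · have hAA : ⁅K.map π, K.map π⁆ = ⊥ := by
        rw [← map_commutator, Subgroup.map_eq_bot_iff]
        exact hc.trans hE
      obtain ⟨hAc, hAt⟩ := commute_and_torsionFree hQV hQ hA hAA
        (fun x hx => ⟨1, one_pos, by simpa using hx⟩)
      have hAu : ∀ v ∈ K.map π, ∀ g : Q, engelComm v g n = 1 := by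
        rintro _ ⟨x, hx, rfl⟩ g
        obtain ⟨y, rfl⟩ := hπ g
        obtain ⟨l, hl, hxl⟩ := hu x hx y
        refine hAt _ (engelComm_mem hA (mem_map_of_mem π hx) _ _) l hl ?_
        rw [← map_engelComm, ← map_pow]
        exact hE hxl
      obtain ⟨R, hR, hAR, hRt, hQR⟩ := exists_torsionRadical (K.map π) hA
      obtain ⟨n, rfl⟩ := Nat.exists_eq_succ_of_ne_zero hn.ne'
      have hcR : ⁅K.map π, R⁆ = ⊥ := by
        refine commutator_eq_bot_of_commute fun a ha r hr => ?_
        obtain ⟨l, hl, hrl⟩ := hRt r hr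
        exact commute_of_pow_commute hA hAt hl (fun v hv => hAc v hv _ hrl) n
          (fun v hv => hAu v hv r) a ha
      obtain ⟨hRc, hRf⟩ := commute_and_torsionFree hQV hQ hR hcR hRt
      have hRu : ∀ v ∈ R, ∀ g : Q, engelComm v g (n + 1) = 1 := by
        intro v hv g
        obtain ⟨l, hl, hvl⟩ := hRt v hv
        refine hRf _ (engelComm_mem hR hv _ _) l hl ?_
        rw [← engelComm_pow_of_commute hR hRc hv]
        exact hAu _ hvl g
      obtain ⟨t2, ht2⟩ := hQV.exists_iterComm_eq_bot hR hRc hRf hn hRu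
      have hs := QuotientGroup.mk'_surjective R
      obtain ⟨hXf, t1, ht1⟩ := ih (Q ⧸ R) ((QuotientGroup.mk' R).comp π) (hs.comp hπ)
        (fun x hx => (QuotientGroup.eq_one_iff _).2 (hAR (mem_map_of_mem π hx))) hQR
      rw [← Subgroup.map_map] at hXf ht1
      refine ⟨fun x hx l hl hxl => ?_, t1 + t2, iterComm_eq_bot_of_quotient (W := R) ?_ ht2⟩
      · refine hRf x ((QuotientGroup.eq_one_iff x).1 ?_) l hl hxl
        refine hXf _ (mem_map_of_mem (QuotientGroup.mk' R) hx) l hl ?_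
        exact (map_pow (QuotientGroup.mk' R) x l).symm.trans (by rw [hxl, map_one])
      · rw [map_top_of_surjective _ hs]
        exact ht1

end TameStep

/-! ### The series of a multilinear verbal subgroup -/

section VerbalSeries

variable {α : Type*} {G : Type*} [Group G]

namespace CommTree

/-- The set of values of `[w ^ q, ₙy]` where `w` is the multilinear commutator of the tree. -/
def engelValues (t : CommTree α) (q n : ℕ) (G : Type*) [Group G] : Set G :=
  Set.range fun p : (α → G) × G => engelComm (t.eval p.1 ^ q) p.2 n

/-- The verbal subgroup of a multilinear commutator contains a term of the derived series. -/
theorem exists_derIter_le_sub (t : CommTree α) :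
    ∃ h, derIter (⊤ : Subgroup G) h ≤ t.sub fun _ => ⊤ := by
  have hanti : Antitone (derIter (⊤ : Subgroup G)) :=
    antitone_nat_of_succ_le fun d => commutator_le_self _
  induction t with
  | leaf i => exact ⟨0, le_top⟩
  | node l r ihl ihr =>
    obtain ⟨a, ha⟩ := ihl
    obtain ⟨b, hb⟩ := ihr
    exact ⟨max a b + 1, commutator_mono ((hanti (le_max_left a b)).trans ha)
      ((hanti (le_max_right a b)).trans hb)⟩

variable [DecidableEq α]

/-- If replacing any one `P j` by `⁅P j, P i⁆` brings `sub P` into `E`, then the values of the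
commutator at elements of the `P j` are multiplicative in the variable `i` modulo `E`. So powers of
values are values modulo `E`, and finiteness of the set of Engel values turns into torsion. -/
theorem tameStep_sup_sub {t : CommTree α} (ht : t.Multilinear) {q n : ℕ} (hq : 0 < q)
    (hfin : (t.engelValues q n G).Finite) {P : α → Subgroup G} (hP : ∀ i, (P i).Normal) {i : α}
    (hi : i ∈ t.vars) {E : Subgroup G} (hE : E.Normal) (hder : t.der P (P i) ≤ E) :
    TameStep n E (E ⊔ t.sub P) := by
  have hS := sub_normal hP t
  have hSS : ⁅t.sub P, t.sub P⁆ ≤ E :=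
    (commutator_mono le_rfl (sub_le hP hi)).trans ((sub_commutator_le_der hP (hP i) t).trans hder)
  let π := QuotientGroup.mk' E
  have hπ : ∀ {x}, π x = 1 ↔ x ∈ E := fun {x} => QuotientGroup.eq_one_iff x
  have hSn : ((t.sub P).map π).Normal := hS.map π (QuotientGroup.mk'_surjective E)
  have hSc : ∀ x ∈ (t.sub P).map π, ∀ y ∈ (t.sub P).map π, Commute x y := by
    rintro x hx y hy
    refine commute_of_commutator_eq_bot ?_ hx hy
    rw [← map_commutator]
    exact map_mk_eq_bot_iff.2 hSS
  have hmul : ∀ g : α → G, (∀ j, g j ∈ P j) → ∀ a ∈ P i, ∀ b ∈ P i,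
      π (t.eval (Function.update g i (a * b))) =
        π (t.eval (Function.update g i a)) * π (t.eval (Function.update g i b)) := by
    intro g hg a ha b hb
    have h := hπ.2 (hder (eval_update_mul hP ht hi hg ha hb))
    rw [map_mul, map_inv, mul_inv_eq_one, map_mul] at h
    exact h
  have hpow : ∀ g : α → G, (∀ j, g j ∈ P j) → ∀ c : ℕ,
      π (t.eval (Function.update g i (g i ^ c))) = π (t.eval g) ^ c := by
    intro g hg c
    induction c with
    | zero =>
      have h := hmul g hg 1 (one_mem _) 1 (one_mem _)
      rw [mul_one] at h
      rw [pow_zero, pow_zero]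
      exact left_eq_mul.1 h
    | succ c ih =>
      rw [pow_succ, hmul g hg _ (pow_mem (hg i) c) _ (hg i), ih, Function.update_eq_self, pow_succ]
  have hval : ∀ g : α → G, (∀ j, g j ∈ P j) → ∀ y : G, ∃ l : ℕ, 0 < l ∧
      engelComm (π (t.eval g)) (π y) n ^ l = 1 := by
    intro g hg y
    have hgS : π (t.eval g) ∈ (t.sub P).map π := mem_map_of_mem π (eval_mem_sub hg t)
    have hninj : ¬ Function.Injective fun c : ℕ =>
        engelComm (t.eval (Function.update g i (g i ^ c)) ^ q) y n := by
      intro hinj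
      exact Set.infinite_range_of_injective hinj
        (hfin.subset (by rintro _ ⟨c, rfl⟩; exact ⟨(_, y), rfl⟩))
    have hv : ∀ c : ℕ, π (engelComm (t.eval (Function.update g i (g i ^ c)) ^ q) y n) =
        engelComm (π (t.eval g)) (π y) n ^ (c * q) := by
      intro c
      rw [map_engelComm, map_pow, hpow g hg, ← pow_mul, engelComm_pow_of_commute hSn hSc hgS]
    have key : ∀ c c' : ℕ, c < c' → engelComm (t.eval (Function.update g i (g i ^ c)) ^ q) y n =
        engelComm (t.eval (Function.update g i (g i ^ c')) ^ q) y n →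
        ∃ l : ℕ, 0 < l ∧ engelComm (π (t.eval g)) (π y) n ^ l = 1 := by
      intro c c' hlt he
      have h := congrArg π he
      rw [hv, hv] at h
      obtain ⟨d, rfl⟩ := Nat.exists_eq_add_of_lt hlt
      refine ⟨(d + 1) * q, by positivity, ?_⟩
      rw [add_assoc, add_mul, pow_add] at h
      exact left_eq_mul.1 h
    simp only [Function.Injective, not_forall] at hninj
    obtain ⟨c, c', he, hne⟩ := hninj
    rcases lt_or_gt_of_ne hne with h | h
    · exact key c c' h he
    · exact key c' c h he.symm
  have hall : ∀ x ∈ t.sub P, ∀ y : G, ∃ l : ℕ, 0 < l ∧ engelComm (π x) (π y) n ^ l = 1 := by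
    intro x hx y
    have hle : ∀ z ∈ closure {x | ∃ g : α → G, (∀ i, g i ∈ P i) ∧ t.eval g = x}, z ∈ t.sub P := by
      rw [← sub_eq_closure hP ht]; exact fun z hz => hz
    rw [sub_eq_closure hP ht] at hx
    induction hx using closure_induction with
    | mem z hz =>
      obtain ⟨g, hg, rfl⟩ := hz
      exact hval g hg y
    | one => exact ⟨1, one_pos, by simp [engelComm_one_left]⟩
    | mul a b ha hb iha ihb =>
      obtain ⟨l, hl, h⟩ := iha
      obtain ⟨l', hl', h'⟩ := ihb
      have ha' := mem_map_of_mem π (hle a ha)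
      have hb' := mem_map_of_mem π (hle b hb)
      refine ⟨l * l', by positivity, ?_⟩
      rw [map_mul, engelComm_mul_of_commute hSn hSc ha' hb',
        (hSc _ (engelComm_mem hSn ha' _ n) _ (engelComm_mem hSn hb' _ n)).mul_pow, pow_mul, h,
        mul_comm l, pow_mul, h', one_pow, one_pow, one_mul]
    | inv a ha iha =>
      obtain ⟨l, hl, h⟩ := iha
      refine ⟨l, hl, ?_⟩
      rw [map_inv, engelComm_inv_of_commute hSn hSc (mem_map_of_mem π (hle a ha)), inv_pow, h,
        inv_one]
  have hmap : (E ⊔ t.sub P).map π = (t.sub P).map π := by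
    rw [Subgroup.map_sup, map_mk_eq_bot_iff.2 le_rfl, bot_sup_eq]
  refine ⟨hE, inferInstance, le_sup_left, Or.inr ⟨?_, fun x hx y => ?_⟩⟩
  · refine sup_commutator_le ?_ (commutator_sup_le ?_ hSS)
    · exact commutator_le_left _ _
    · exact commutator_le_right _ _
  · obtain ⟨z, hz, hzx⟩ : π x ∈ (t.sub P).map π := hmap ▸ mem_map_of_mem π hx
    obtain ⟨l, hl, h⟩ := hall z hz y
    refine ⟨l, hl, hπ.1 ?_⟩
    rw [map_pow, map_engelComm, ← hzx, h]

/-- The tuples of levels of a descending series `L` of normal subgroups give a tame chain for the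
commutator subgroups `sub`.  The tuple is increased in one entry at a time; linearity is used in a
variable whose level is maximal. -/
theorem tameChain_levels [Fintype α] {t : CommTree α} (ht : t.Multilinear) {q n : ℕ} (hq : 0 < q)
    (hfin : (t.engelValues q n G).Finite) {L : ℕ → Subgroup G} (hL : ∀ a, (L a).Normal)
    {c s : ℕ} (hcomm : ∀ a b, a ≤ b → c ≤ b → ⁅L a, L b⁆ ≤ L (a + 1))
    (hanti : Antitone L) {F : Subgroup G} (hF : F.Normal) (hs : L s ≤ F) (d : ℕ) :
    ∀ a : α → ℕ, ∑ j, (s - a j) ≤ d → (∃ j ∈ t.vars, c ≤ a j) →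
      TameChain n F (F ⊔ t.sub fun j => L (a j)) := by
  induction d with
  | zero =>
    intro a ha _
    obtain ⟨j, hj⟩ := t.vars_nonempty
    have h0 : s - a j = 0 := by
      have := Finset.single_le_sum (f := fun j => s - a j) (fun _ _ => Nat.zero_le _)
        (Finset.mem_univ j)
      omega
    have hle : t.sub (fun j => L (a j)) ≤ F :=
      (sub_le (fun j => hL _) hj).trans ((hanti (by omega)).trans hs)
    rw [sup_eq_left.2 hle]
    exact ReflTransGen.refl
  | succ d ih =>
    intro a ha hca
    by_cases hbig : ∃ j ∈ t.vars, s ≤ a j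
    · obtain ⟨j, hj, hsj⟩ := hbig
      have hle : t.sub (fun j => L (a j)) ≤ F :=
        (sub_le (fun j => hL _) hj).trans ((hanti hsj).trans hs)
      rw [sup_eq_left.2 hle]
      exact ReflTransGen.refl
    · push Not at hbig
      classical
      let V : Finset α := Finset.univ.filter (· ∈ t.vars)
      have hV : ∀ {j}, j ∈ V ↔ j ∈ t.vars := by simp [V]
      obtain ⟨j0, hj0, hcj0⟩ := hca
      obtain ⟨i, hiV, himax⟩ := V.exists_max_image a ⟨j0, hV.2 hj0⟩
      let f : α → Subgroup G := fun j => t.sub fun x => L (Function.update a j (a j + 1) x)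
      have hfN : ∀ j, (f j).Normal := fun j => sub_normal (fun x => hL _) t
      have hchain : ∀ j ∈ V, TameChain n F (F ⊔ f j) := by
        intro j hj
        refine ih _ ?_ ⟨j0, hj0, ?_⟩
        · have hlt : ∑ x, (s - Function.update a j (a j + 1) x) < ∑ x, (s - a x) := by
            refine Finset.sum_lt_sum (fun x _ => ?_) ⟨j, Finset.mem_univ j, ?_⟩
            · rcases eq_or_ne x j with rfl | hx
              · rw [Function.update_self]; omega
              · rw [Function.update_of_ne hx]
            · rw [Function.update_self]
              have := hbig j (hV.1 hj)
              omega
          omega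
        · rcases eq_or_ne j0 j with rfl | hx
          · rw [Function.update_self]; omega
          · rwa [Function.update_of_ne hx]
      have hsup := TameChain.finset_sup f hfN V hchain
      have hfle : V.sup f ≤ t.sub fun j => L (a j) := by
        refine Finset.sup_le fun j _ => sub_mono (fun x => hanti ?_) t
        rcases eq_or_ne x j with rfl | hx
        · rw [Function.update_self]; omega
        · rw [Function.update_of_ne hx]
      have hVN : (V.sup f).Normal := by
        rw [Finset.sup_eq_iSup]
        exact biSup_normal (V : Set α) f fun j _ => hfN j
      have hstep := tameStep_sup_sub ht hq hfin (P := fun j => L (a j)) (fun j => hL _)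
        (hV.1 hiV) (E := F ⊔ V.sup f) inferInstance (by
          refine (der_le_iSup (fun j => hL _) (hL _) ht).trans (iSup_le fun j => ?_)
          refine le_trans ?_ ((Finset.le_sup (f := f) (hV.2 j.2)).trans le_sup_right)
          refine sub_mono (fun x => ?_) t
          rcases eq_or_ne x j with rfl | hx
          · rw [Function.update_self, Function.update_self]
            exact hcomm _ _ (himax _ (hV.2 j.2)) (hcj0.trans (himax _ (hV.2 hj0)))
          · rw [Function.update_of_ne hx, Function.update_of_ne hx])
      rw [sup_assoc, sup_eq_right.2 hfle] at hstep
      exact hsup.trans (ReflTransGen.single hstep)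

end CommTree

/-- If `N` has finite index and `⁅X, N⁆ ≤ E`, then `X / E` is central-by-finite, and by the
transfer into its centre the derived subgroup of `X / E` has finite exponent. -/
theorem torsionMod_sup_commutator {E X N : Subgroup G} [E.Normal]
    (hN : N.FiniteIndex) (h : ⁅X, N⁆ ≤ E) : TorsionMod E (E ⊔ ⁅X, X⁆) := by
  let π := QuotientGroup.mk' E
  let Y := X.map π
  let Z := (N.map π).subgroupOf Y
  have hZ : Z ≤ center Y := by
    intro z hz
    rw [mem_center_iff]
    intro g
    refine Subtype.ext (commute_of_commutator_eq_bot (A := Y) (B := N.map π) ?_ g.2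
      (mem_subgroupOf.1 hz)).eq
    rw [← map_commutator]
    exact map_mk_eq_bot_iff.2 h
  have hNi : (N.map π).FiniteIndex :=
    ⟨fun h0 => hN.index_ne_zero (Nat.eq_zero_of_zero_dvd
      (h0 ▸ N.index_map_dvd (QuotientGroup.mk'_surjective E)))⟩
  have hZi : Z.FiniteIndex := inferInstance
  have hfc : (center Y).FiniteIndex := finiteIndex_of_le hZ
  let φ := MonoidHom.transferCenterPow Y
  have hker : commutator Y ≤ φ.ker := by
    rw [commutator_def, commutator_le]
    intro a _ b _
    rw [MonoidHom.mem_ker, map_commutatorElement, commutatorElement_eq_one_iff_mul_comm]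
    exact Subtype.ext (mem_center_iff.1 (φ b).2 _)
  intro x hx
  refine ⟨(center Y).index, Nat.pos_of_ne_zero hfc.index_ne_zero, ?_⟩
  have hmap : π x ∈ (commutator Y).map Y.subtype := by
    rw [map_subtype_commutator, ← map_commutator]
    have h1 := mem_map_of_mem π hx
    rwa [Subgroup.map_sup, map_mk_eq_bot_iff.2 le_rfl, bot_sup_eq] at h1
  obtain ⟨y, hy, hyx⟩ := hmap
  have h2 := hker hy
  rw [MonoidHom.mem_ker] at h2
  have h3 := MonoidHom.transferCenterPow_apply y
  rw [show MonoidHom.transferCenterPow Y y = 1 from h2] at h3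
  rw [← QuotientGroup.eq_one_iff]
  change π (x ^ (center Y).index) = 1
  rw [map_pow, ← hyx, ← map_pow, ← h3]
  rfl

open CommTree in
/-- In a soluble-by-finite group with finitely many values of `[w ^ q, ₙy]` there is a tame chain
from the trivial subgroup to the verbal subgroup of `w`. -/
theorem tameChain_bot_sub [DecidableEq α] [Fintype α] (hG : VirtSol G) {t : CommTree α}
    (ht : t.Multilinear) {q n : ℕ} (hq : 0 < q) (hfin : (t.engelValues q n G).Finite) :
    TameChain n (⊥ : Subgroup G) (t.sub fun _ => ⊤) := by
  obtain ⟨N, hN, hNi, s, hs⟩ := hG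
  set X : Subgroup G := t.sub fun _ => ⊤ with hXdef
  have hX : X.Normal := sub_normal (fun _ => inferInstance) t
  -- the series `G ≥ N ≥ N' ≥ ⋯`, used for tuples with at least one entry below `G`
  let L : ℕ → Subgroup G := fun a => Nat.casesOn a ⊤ (derIter N)
  have hL : ∀ a, (L a).Normal := by
    rintro (_ | a)
    · exact inferInstanceAs (⊤ : Subgroup G).Normal
    · exact derIter_normal hN a
  have hanti : Antitone L := by
    refine antitone_nat_of_succ_le ?_
    rintro (_ | a)
    · exact le_top
    · exact commutator_le_self _
  have hcomm : ∀ a b, a ≤ b → 1 ≤ b → ⁅L a, L b⁆ ≤ L (a + 1) := by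
    rintro (_ | a) b hab hb
    · exact (commutator_le_right (h := hL b) _ _).trans (hanti hb)
    · exact commutator_mono le_rfl (hanti hab)
  let f : α → Subgroup G := fun j => t.sub fun x => L (Function.update (fun _ => 0) j 1 x)
  have hfN : ∀ j, (f j).Normal := fun j => sub_normal (fun x => hL _) t
  classical
  let V : Finset α := Finset.univ.filter (· ∈ t.vars)
  have hV : ∀ {j}, j ∈ V ↔ j ∈ t.vars := by simp [V]
  have h1 : TameChain n ⊥ (⊥ ⊔ V.sup f) := by
    refine TameChain.finset_sup f hfN V fun j hj => ?_
    exact tameChain_levels ht hq hfin hL hcomm hanti inferInstance (s := s + 1) hs.le _ _ le_rfl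
      ⟨j, hV.1 hj, by rw [Function.update_self]⟩
  rw [bot_sup_eq] at h1
  have hE : (V.sup f).Normal := by
    rw [Finset.sup_eq_iSup]
    exact biSup_normal (V : Set α) f fun j _ => hfN j
  have hXN : ⁅X, N⁆ ≤ V.sup f := by
    refine (sub_commutator_le_der (fun _ => inferInstance) hN t).trans
      ((der_le_iSup (fun _ => inferInstance) hN ht).trans (iSup_le fun j => ?_))
    refine le_trans (sub_mono (fun x => ?_) t) (Finset.le_sup (f := f) (hV.2 j.2))
    rcases eq_or_ne x j with rfl | hx
    · rw [Function.update_self, Function.update_self]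
      exact commutator_le_right _ _
    · rw [Function.update_of_ne hx, Function.update_of_ne hx]
      exact le_top
  have h2 : TameStep n (V.sup f) (V.sup f ⊔ ⁅X, X⁆) :=
    ⟨hE, inferInstance, le_sup_left, Or.inl (torsionMod_sup_commutator hNi hXN)⟩
  obtain ⟨h, hh⟩ := exists_derIter_le_sub (G := G) t
  have hEX : V.sup f ≤ X := Finset.sup_le fun j _ => sub_mono (fun _ => le_top) t
  have hanti' : Antitone (derIter (⊤ : Subgroup G)) :=
    antitone_nat_of_succ_le fun d => commutator_le_self _
  have h3 : TameChain n (V.sup f ⊔ ⁅X, X⁆)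
      (V.sup f ⊔ ⁅X, X⁆ ⊔ t.sub fun j => derIter (⊤ : Subgroup G) ((fun _ => 0 : α → ℕ) j)) := by
    obtain ⟨j, hj⟩ := t.vars_nonempty
    refine tameChain_levels ht hq hfin (fun a => derIter_normal inferInstance a) (c := 0)
      (s := h + 1) (fun a b hab _ => commutator_mono le_rfl (hanti' hab)) hanti' inferInstance
      ((commutator_mono hh hh).trans le_sup_right) _ _ le_rfl ⟨j, hj, Nat.zero_le _⟩
  have h4 : V.sup f ⊔ ⁅X, X⁆ ⊔ (t.sub fun j => derIter (⊤ : Subgroup G) ((fun _ => 0 : α → ℕ) j))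
      = X := sup_eq_right.2 (sup_le hEX (commutator_le_self X))
  rw [h4] at h3
  exact (h1.trans (ReflTransGen.single h2)).trans h3

end VerbalSeries

/-! ### Nilpotent extensions and polynomial sequences -/

section Hall

variable {M : Type*} [Group M]

theorem iterComm_sup_le {P Q D : Subgroup M} (hP : P.Normal) (hQ : Q.Normal) (hD : D.Normal)
    (t : ℕ) : iterComm (P ⊔ Q) D t ≤ iterComm P D t ⊔ iterComm Q D t := by
  induction t with
  | zero => exact le_rfl
  | succ t ih =>
    have h1 := iterComm_normal hP hD t
    have h2 := iterComm_normal hQ hD t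
    have h3 := iterComm_normal hP hD (t + 1)
    have h4 := iterComm_normal hQ hD (t + 1)
    exact (commutator_mono ih le_rfl).trans (sup_commutator_le le_sup_left le_sup_right)

theorem iterComm_le_of_le {E V D : Subgroup M} [E.Normal] (h : V ≤ E) (t : ℕ) :
    iterComm V D t ≤ E := by
  induction t with
  | zero => exact h
  | succ t ih => exact (commutator_mono ih le_rfl).trans (commutator_le_left _ _)

theorem iterComm_succ' (V D : Subgroup M) (t : ℕ) :
    iterComm V D (t + 1) = iterComm ⁅V, D⁆ D t := by
  rw [add_comm, iterComm_add]; rfl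

/-- The Leibniz rule for iterated commutators of `⁅A, B⁆` with the whole group. -/
theorem iterComm_commutator_le {E A' B' : Subgroup M} [E.Normal] (a : ℕ) : ∀ (b : ℕ)
    (A B : Subgroup M), A.Normal → B.Normal → iterComm A ⊤ a ≤ A' → iterComm B ⊤ b ≤ B' →
    ⁅A', B⁆ ≤ E → ⁅A, B'⁆ ≤ E → iterComm ⁅A, B⁆ ⊤ (a + b) ≤ E := by
  induction a with
  | zero =>
    intro b A B _ _ hA _ h1 _
    exact iterComm_le_of_le ((commutator_mono hA le_rfl).trans h1) _
  | succ a iha =>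
    intro b
    induction b with
    | zero =>
      intro A B _ _ _ hB _ h2
      exact iterComm_le_of_le ((commutator_mono le_rfl hB).trans h2) _
    | succ b ihb =>
      intro A B hAN hBN hA hB h1 h2
      rw [show a + 1 + (b + 1) = (a + 1 + b) + 1 by ring, iterComm_succ']
      have h3 : ⁅⁅A, B⁆, (⊤ : Subgroup M)⁆ ≤ ⁅⁅A, (⊤ : Subgroup M)⁆, B⁆ ⊔ ⁅A, ⁅B, (⊤ : Subgroup M)⁆⁆ :=
        three_subgroups_le le_sup_left le_sup_right
      refine (iterComm_mono h3 le_rfl _).trans ((iterComm_sup_le inferInstance inferInstance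
        inferInstance _).trans (sup_le ?_ ?_))
      · rw [show a + 1 + b = a + (b + 1) by ring]
        rw [iterComm_succ'] at hA
        exact iha (b + 1) _ B inferInstance hBN hA hB h1
          ((commutator_mono (commutator_le_left _ _) le_rfl).trans h2)
      · rw [iterComm_succ'] at hB
        exact ihb A _ hAN inferInstance hA hB
          ((commutator_mono le_rfl (commutator_le_left _ _)).trans h1) h2

/-- Hall's criterion: a group acts nilpotently on a nilpotent normal subgroup `N` as soon as it
acts nilpotently on `N` modulo `⁅N, N⁆`. -/
theorem exists_iterComm_eq_bot_of_hall {N : Subgroup M} (hN : N.Normal) {r c : ℕ}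
    (hr : iterComm N ⊤ r ≤ ⁅N, N⁆) (hc : iterComm N N c = ⊥) : ∃ k, iterComm N ⊤ k = ⊥ := by
  have hγ : ∀ i, (iterComm N N i).Normal := iterComm_normal hN hN
  have hstep : ∀ i, ∃ t, iterComm (iterComm N N i) ⊤ t ≤ iterComm N N (i + 1) := by
    intro i
    induction i with
    | zero => exact ⟨r, hr⟩
    | succ i ih =>
      obtain ⟨t, ht⟩ := ih
      have := hγ (i + 2)
      refine ⟨t + r, iterComm_commutator_le (E := iterComm N N (i + 2)) t r _ N (hγ i) hN ht hr
        le_rfl ?_⟩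
      rw [commutator_comm]
      refine three_subgroups_le ?_ ?_
      · rw [commutator_comm N]; exact le_rfl
      · rw [commutator_comm N, commutator_comm N]; exact le_rfl
  have hall : ∀ i, ∃ t, iterComm N ⊤ t ≤ iterComm N N i := by
    intro i
    induction i with
    | zero => exact ⟨0, le_rfl⟩
    | succ i ih =>
      obtain ⟨t, ht⟩ := ih
      obtain ⟨t', ht'⟩ := hstep i
      refine ⟨t + t', ?_⟩
      rw [iterComm_add]
      exact (iterComm_mono ht le_rfl t').trans ht'
  obtain ⟨k, hk⟩ := hall c
  exact ⟨k, eq_bot_iff.2 (hk.trans hc.le)⟩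

/-- If `N = ⟨u, y, z⟩` is nilpotent and `σ` acts on it by fixing `u` and `y` and by `z ↦ z y`, then
`σ` acts nilpotently. -/
theorem exists_engelComm_eq_one {u y z σ : M} (htop : closure {u, y, z, σ} = (⊤ : Subgroup M))
    (hu : Commute u σ) (hy : Commute y σ) (hz : groupComm z σ = y) {c : ℕ}
    (hc : iterComm (closure {u, y, z}) (closure {u, y, z}) c = ⊥) :
    ∃ k, ∀ x ∈ closure {u, y, z}, engelComm x σ k = 1 := by
  set N := closure {u, y, z} with hNdef
  have huN : u ∈ N := subset_closure (by simp)
  have hyN : y ∈ N := subset_closure (by simp)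
  have hzN : z ∈ N := subset_closure (by simp)
  have hz1 : σ⁻¹ * z * σ = z * y := by rw [← hz]; simp [groupComm, mul_assoc]
  have hz2 : σ * z * σ⁻¹ = z * y⁻¹ := by
    have h1 : z = σ * (z * y) * σ⁻¹ := by rw [← hz1]; simp [mul_assoc]
    have h2 : σ * (z * y) * σ⁻¹ = σ * z * σ⁻¹ * y := by
      rw [← mul_assoc, mul_assoc _ y, (hy.inv_right).eq]; simp [mul_assoc]
    rw [h2] at h1
    exact eq_mul_inv_of_mul_eq h1.symm
  have hconj : ∀ τ : M, τ * u * τ⁻¹ ∈ N → τ * y * τ⁻¹ ∈ N → τ * z * τ⁻¹ ∈ N →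
      ∀ x ∈ N, τ * x * τ⁻¹ ∈ N := by
    intro τ h1 h2 h3 x hx
    have hle : N ≤ N.comap (MulAut.conj τ).toMonoidHom := by
      rw [hNdef, closure_le]
      rintro x (rfl | rfl | rfl) <;> assumption
    exact hle hx
  have hN : N.Normal := by
    rw [← normalizer_eq_top_iff, eq_top_iff, ← htop, closure_le]
    have hle := le_normalizer (H := N)
    rintro x (rfl | rfl | rfl | rfl)
    · exact hle huN
    · exact hle hyN
    · exact hle hzN
    · refine mem_normalizer_iff.2 fun h => ⟨hconj x ?_ ?_ ?_ h, fun hh => ?_⟩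
      · rwa [← hu.eq, mul_inv_cancel_right]
      · rwa [← hy.eq, mul_inv_cancel_right]
      · rw [hz2]; exact N.mul_mem hzN (N.inv_mem hyN)
      · have := hconj x⁻¹ (by rwa [inv_inv, mul_assoc, hu.eq, inv_mul_cancel_left])
          (by rwa [inv_inv, mul_assoc, hy.eq, inv_mul_cancel_left])
          (by rw [inv_inv, hz1]; exact N.mul_mem hzN hyN) _ hh
        simpa [mul_assoc] using this
  have hmemN : ∀ {a b : M}, a ∈ N → b ∈ N → ⁅a, b⁆ ∈ ⁅N, N⁆ := commutator_mem_commutator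
  have hcσ : ∀ {a : M}, Commute a σ → ⁅a, σ⁆ ∈ ⁅N, N⁆ := fun h => by
    rw [commutatorElement_eq_one_iff_commute.2 h]; exact one_mem _
  have hy1 : ⁅zpowers y, (⊤ : Subgroup M)⁆ ≤ ⁅N, N⁆ := by
    rw [← htop, zpowers_eq_closure]
    refine closure_commutator_closure_le ?_
    rintro s rfl t (rfl | rfl | rfl | rfl)
    · exact hmemN hyN huN
    · exact hmemN hyN hyN
    · exact hmemN hyN hzN
    · exact hcσ hy
  have hL1 : ⁅zpowers y ⊔ ⁅N, N⁆, (⊤ : Subgroup M)⁆ ≤ ⁅N, N⁆ :=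
    sup_commutator_le hy1 (commutator_le_left _ _)
  have hL : (zpowers y ⊔ ⁅N, N⁆).Normal := commutator_top_right_le_iff.1 (hL1.trans le_sup_right)
  have hyL : y ∈ zpowers y ⊔ ⁅N, N⁆ := le_sup_left (b := ⁅N, N⁆) (mem_zpowers y)
  have hN1 : ⁅N, (⊤ : Subgroup M)⁆ ≤ zpowers y ⊔ ⁅N, N⁆ := by
    rw [← htop]
    nth_rewrite 1 [hNdef]
    refine closure_commutator_closure_le ?_
    intro s hs t ht
    have hsN : s ∈ N := subset_closure hs
    rcases ht with rfl | rfl | rfl | rfl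
    · exact le_sup_right (a := zpowers y) (hmemN hsN huN)
    · exact le_sup_right (a := zpowers t) (hmemN hsN hyN)
    · exact le_sup_right (a := zpowers y) (hmemN hsN hzN)
    · rcases hs with rfl | rfl | rfl
      · exact le_sup_right (a := zpowers y) (hcσ hu)
      · exact le_sup_right (a := zpowers s) (hcσ hy)
      · have e : ⁅s, t⁆ = s * (s * y⁻¹)⁻¹ := by rw [← hz2]; simp [commutatorElement_def, mul_assoc]
        rw [e, mul_inv_rev, inv_inv]
        have := hL.conj_mem y hyL s
        rwa [mul_assoc] at this
  have hr : iterComm N ⊤ 2 ≤ ⁅N, N⁆ := (commutator_mono hN1 le_rfl).trans hL1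
  obtain ⟨k, hk⟩ := exists_iterComm_eq_bot_of_hall hN hr hc
  refine ⟨k, fun x hx => ?_⟩
  have := engelComm_mem_iterComm hx (mem_top σ) k
  rwa [hk, mem_bot] at this

end Hall

section Polynomial

variable {G : Type*} [Group G]

/-- The multiplicative difference operator on sequences in a group. -/
def diffSeq (f : ℤ → G) : ℤ → G := fun j => (f j)⁻¹ * f (j + 1)

/-- A polynomial sequence in a torsion-free group that takes only finitely many values is
constant. -/
theorem eq_of_diffSeq_iterate_eq_one {X : Subgroup G} (hX : TorsionFree X) (k : ℕ) :
    ∀ f : ℤ → G, (∀ j, f j ∈ X) → (Set.range f).Finite → diffSeq^[k] f = 1 → ∀ j, f j = f 0 := by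
  induction k with
  | zero =>
    intro f _ _ h j
    rw [Function.iterate_zero, id] at h
    rw [h]; rfl
  | succ k ih =>
    intro f hf hfin h j
    have hdfin : (Set.range (diffSeq f)).Finite := by
      refine (Set.Finite.image2 (fun a b => a⁻¹ * b) hfin hfin).subset ?_
      rintro _ ⟨j, rfl⟩
      exact ⟨f j, ⟨j, rfl⟩, f (j + 1), ⟨j + 1, rfl⟩, rfl⟩
    have hd := ih (diffSeq f) (fun j => X.mul_mem (X.inv_mem (hf j)) (hf _)) hdfin h
    have hr : ∀ j, f (j + 1) = f j * diffSeq f 0 := fun j => by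
      rw [← hd j]; simp [diffSeq]
    have hrX : diffSeq f 0 ∈ X := X.mul_mem (X.inv_mem (hf 0)) (hf _)
    generalize diffSeq f 0 = r at hr hrX
    have hpow : ∀ a : ℕ, f a = f 0 * r ^ a := by
      intro a
      induction a with
      | zero => simp
      | succ a iha => rw [Nat.cast_succ, hr, iha, pow_succ, mul_assoc]
    -- finitely many values `f 0 * r ^ a` force `r` to have finite order
    have hr1 : r = 1 := by
      have hninj : ¬ Function.Injective fun a : ℕ => f a := fun hinj =>
        Set.infinite_range_of_injective hinj
          (hfin.subset (by rintro _ ⟨a, rfl⟩; exact ⟨a, rfl⟩))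
      have key : ∀ a b : ℕ, a < b → f a = f b → r = 1 := by
        intro a b hab h
        rw [hpow, hpow] at h
        obtain ⟨d, rfl⟩ := Nat.exists_eq_add_of_lt hab
        rw [add_assoc, pow_add, ← mul_assoc] at h
        exact hX r hrX (d + 1) (by omega) (left_eq_mul.1 h)
      simp only [Function.Injective, not_forall] at hninj
      obtain ⟨a, b, he, hne⟩ := hninj
      rcases lt_or_gt_of_ne hne with h | h
      · exact key a b h he
      · exact key b a h he.symm
    subst hr1
    simp only [mul_one] at hr
    induction j with
    | zero => rfl
    | succ j ihj => rw [hr, ihj]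
    | pred j ihj => rw [← ihj, ← hr, sub_add_cancel]

/-- The shift `f ↦ f (· - 1)` of sequences. -/
def shift (G : Type*) [Group G] : MulAut (ℤ → G) where
  toFun f := fun j => f (j - 1)
  invFun f := fun j => f (j + 1)
  left_inv f := by funext j; simp
  right_inv f := by funext j; simp
  map_mul' _ _ := rfl

open SemidirectProduct in
/-- In the semidirect product of the group of sequences with its automorphisms, commutation with
the shift is the difference operator. -/
theorem engelComm_inl_inr_shift (f : ℤ → G) (k : ℕ) :
    engelComm (inl f : (ℤ → G) ⋊[MonoidHom.id _] MulAut (ℤ → G)) (inr (shift G)) k =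
      inl (diffSeq^[k] f) := by
  induction k with
  | zero => rfl
  | succ k ih =>
    rw [Function.iterate_succ_apply', engelComm, ih]
    generalize diffSeq^[k] f = h
    have h1 := inl_aut_inv (φ := MonoidHom.id (MulAut (ℤ → G))) (shift G) h
    rw [groupComm, mul_assoc, mul_assoc, ← mul_assoc (inr (shift G))⁻¹, ← map_inv (inr), ← h1,
      ← map_inv, ← map_mul]
    rfl

/-- If the whole group acts nilpotently on a normal subgroup `X`, and `N` is a group of sequences
with values in `X ⟨y⟩`, then `N` is nilpotent. -/
theorem exists_iterComm_pi_eq_bot {X : Subgroup G} (hX : X.Normal) {f : ℕ}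
    (hf : iterComm X ⊤ f = ⊥) (y : G) {N : Subgroup (ℤ → G)}
    (hN : ∀ p ∈ N, ∀ j, p j ∈ X ⊔ zpowers y) : iterComm N N (f + 1) = ⊥ := by
  set Γ := X ⊔ zpowers y with hΓ
  have h1 : ⁅Γ, Γ⁆ ≤ X := by
    have hzz : ⁅zpowers y, zpowers y⁆ ≤ X := by
      rw [zpowers_eq_closure]
      refine closure_commutator_closure_le ?_
      rintro s rfl t rfl
      rw [commutatorElement_self]
      exact one_mem X
    refine sup_commutator_le (commutator_le_left _ _) (commutator_sup_le ?_ hzz)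
    exact commutator_le_right _ _
  have h2 : iterComm Γ Γ (f + 1) = ⊥ := by
    rw [iterComm_succ', eq_bot_iff, ← hf]
    exact iterComm_mono h1 le_top f
  have h3 : ∀ t, ∀ p ∈ iterComm N N t, ∀ j, p j ∈ iterComm Γ Γ t := by
    intro t
    induction t with
    | zero => exact hN
    | succ t ih =>
      intro p hp j
      have hle : iterComm N N (t + 1) ≤
          (iterComm Γ Γ (t + 1)).comap (Pi.evalMonoidHom (fun _ : ℤ => G) j) := by
        refine commutator_le.2 fun a ha b hb => ?_
        rw [mem_comap, map_commutatorElement]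
        exact commutator_mem_commutator (ih a ha j) (hN b hb j)
      exact hle hp
  rw [eq_bot_iff]
  intro p hp
  rw [mem_bot]
  funext j
  have := h3 _ p hp j
  rwa [h2, mem_bot] at this

open SemidirectProduct in
/-- If the group acts nilpotently on a torsion-free normal subgroup `X` containing `u`, then
`j ↦ [u, ₙyʲ]` is a polynomial sequence; so if it takes finitely many values, it is constant and
equal to its value `1` at `j = 0`. -/
theorem engelComm_eq_one_of_finite {X : Subgroup G} (hX : X.Normal) (htf : TorsionFree X) {f : ℕ}
    (hf : iterComm X ⊤ f = ⊥) {u : G} (hu : u ∈ X) (y : G) {n : ℕ} (hn : 0 < n)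
    (hfin : (Set.range fun j : ℤ => engelComm u (y ^ j) n).Finite) : engelComm u y n = 1 := by
  let cu : ℤ → G := fun _ => u
  let cy : ℤ → G := fun _ => y
  let z : ℤ → G := fun j => y ^ j
  let N0 : Subgroup (ℤ → G) := closure {cu, cy, z}
  have hN0 : iterComm N0 N0 (f + 1) = ⊥ := by
    refine exists_iterComm_pi_eq_bot hX hf y fun p hp j => ?_
    have hle : N0 ≤ (X ⊔ zpowers y).comap (Pi.evalMonoidHom (fun _ : ℤ => G) j) := by
      rw [closure_le]
      have hy : zpowers y ≤ X ⊔ zpowers y := le_sup_right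
      rintro x (rfl | rfl | rfl)
      · exact le_sup_left (b := zpowers y) hu
      · exact hy (mem_zpowers y)
      · exact hy (zpow_mem_zpowers y j)
    exact hle hp
  let S := (ℤ → G) ⋊[MonoidHom.id _] MulAut (ℤ → G)
  let ι : (ℤ → G) →* S := inl
  let σ : S := inr (shift G)
  have hgc : ∀ p, groupComm (ι p) σ = ι (diffSeq p) := fun p => engelComm_inl_inr_shift p 1
  let M : Subgroup S := closure {ι cu, ι cy, ι z, σ}
  have hmem : ∀ x ∈ ({ι cu, ι cy, ι z, σ} : Set S), x ∈ M := fun x hx => subset_closure hx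
  let u' : M := ⟨ι cu, hmem _ (by simp)⟩
  let y' : M := ⟨ι cy, hmem _ (by simp)⟩
  let z' : M := ⟨ι z, hmem _ (by simp)⟩
  let σ' : M := ⟨σ, hmem _ (by simp)⟩
  have htop : closure {u', y', z', σ'} = (⊤ : Subgroup M) := by
    refine map_injective M.subtype_injective ?_
    rw [MonoidHom.map_closure, ← MonoidHom.range_eq_map, range_subtype]
    simp only [Set.image_insert_eq, Set.image_singleton]
    rfl
  have hmapN : (closure {u', y', z'}).map M.subtype = N0.map ι := by
    rw [MonoidHom.map_closure, MonoidHom.map_closure]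
    simp only [Set.image_insert_eq, Set.image_singleton]
    rfl
  have hconst : ∀ c : G, diffSeq (fun _ : ℤ => c) = 1 := fun c => by
    funext j; simp [diffSeq]
  obtain ⟨k, hk⟩ := exists_engelComm_eq_one (u := u') (y := y') (z := z') (σ := σ') htop
    (groupComm_eq_one_iff.1 (Subtype.ext ((hgc cu).trans (by rw [hconst, map_one]; rfl))))
    (groupComm_eq_one_iff.1 (Subtype.ext ((hgc cy).trans (by rw [hconst, map_one]; rfl))))
    (Subtype.ext ((hgc z).trans (congrArg ι (by
      funext j
      simp [diffSeq, z, cy, zpow_add]))))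
    (c := f + 1) (by
      refine map_injective M.subtype_injective ?_
      rw [map_iterComm, hmapN, ← map_iterComm, hN0, Subgroup.map_bot, Subgroup.map_bot])
  let p : ℤ → G := engelComm cu z n
  have hp : ∀ j, p j = engelComm u (y ^ j) n := fun j =>
    map_engelComm (Pi.evalMonoidHom (fun _ : ℤ => G) j) cu z n
  have hpk : diffSeq^[k] p = 1 := by
    have h1 := hk (engelComm u' z' n) (by
      have hu' : u' ∈ closure {u', y', z'} := subset_closure (by simp)
      have hz' : z' ∈ closure {u', y', z'} := subset_closure (by simp)
      have : ∀ m, engelComm u' z' m ∈ closure {u', y', z'} := by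
        intro m
        induction m with
        | zero => exact hu'
        | succ m ih =>
          exact mul_mem (mul_mem (mul_mem (inv_mem ih) (inv_mem hz')) ih) hz'
      exact this n)
    have h2 := congrArg M.subtype h1
    rw [map_engelComm, map_engelComm, map_one] at h2
    have h3 : engelComm (M.subtype u') (M.subtype z') n = ι p := (map_engelComm ι cu z n).symm
    rw [h3] at h2
    have h4 := engelComm_inl_inr_shift p k
    have h5 : ι (diffSeq^[k] p) = 1 := h4.symm.trans h2
    exact inl_injective (h5.trans (map_one ι).symm)
  have hconst' := eq_of_diffSeq_iterate_eq_one htf k p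
    (fun j => by rw [hp]; exact engelComm_mem hX hu _ n)
    (by rw [show p = fun j => engelComm u (y ^ j) n from funext hp]; exact hfin) hpk 1
  rw [hp, hp, zpow_one, zpow_zero] at hconst'
  rw [hconst']
  obtain ⟨n, rfl⟩ := Nat.exists_eq_succ_of_ne_zero hn.ne'
  simp [engelComm, groupComm]

end Polynomial

/-! ### Finiteness of the verbal subgroup -/

section Finiteness

theorem CommTree.engelValues_quotient_finite {α : Type*} {G : Type*} [Group G] {t : CommTree α}
    {q n : ℕ} (h : (t.engelValues q n G).Finite) (T : Subgroup G) [T.Normal] :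
    (t.engelValues q n (G ⧸ T)).Finite := by
  refine (h.image (QuotientGroup.mk' T)).subset ?_
  rintro _ ⟨⟨g, y⟩, rfl⟩
  have hs := QuotientGroup.mk'_surjective T
  choose g' hg' using fun i => hs (g i)
  obtain ⟨y', rfl⟩ := hs y
  refine ⟨_, ⟨(g', y'), rfl⟩, ?_⟩
  rw [map_engelComm, map_pow, map_eval]
  simp only [hg']

/-- In a soluble-by-finite group with finitely many values of `[w ^ q, ₙy]`, these values generate
a finite group. They lie in the largest normal torsion subgroup, since modulo this subgroup they are
trivial. -/
theorem VirtSol.finite_closure_engelValues {α : Type*} [Fintype α] {G : Type*} [Group G]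
    (hG : VirtSol G) {t : CommTree α} (ht : t.Multilinear) {q n : ℕ} (hq : 0 < q) (hn : 0 < n)
    (hfin : (t.engelValues q n G).Finite) : Finite (closure (t.engelValues q n G)) := by
  classical
  obtain ⟨T, hT, -, hTt, hTn⟩ := exists_torsionRadical (⊥ : Subgroup G) inferInstance
  have hs := QuotientGroup.mk'_surjective T
  have hQ : VirtSol (G ⧸ T) := hG.of_surjective _ hs
  have hfinQ := CommTree.engelValues_quotient_finite hfin T
  obtain ⟨hXt, f, hf⟩ := (tameChain_bot_sub hQ ht hq hfinQ).torsionFree_and_exists_iterComm hQ hn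
    (G ⧸ T) (MonoidHom.id _) Function.surjective_id bot_le hTn
  rw [Subgroup.map_id] at hXt hf
  have hle : closure (t.engelValues q n G) ≤ T := by
    rw [closure_le]
    rintro _ ⟨⟨g, y⟩, rfl⟩
    refine (QuotientGroup.eq_one_iff _).1 ?_
    change QuotientGroup.mk' T _ = 1
    rw [map_engelComm, map_pow, CommTree.map_eval]
    refine engelComm_eq_one_of_finite (CommTree.sub_normal (fun _ => inferInstance) t) hXt hf
      (pow_mem (CommTree.eval_mem_sub (fun _ => mem_top _) t) q) _ hn (hfinQ.subset ?_)
    rintro _ ⟨j, rfl⟩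
    exact ⟨(_, _), rfl⟩
  refine (hG.subgroup _).finite ?_ fun x => ?_
  · rw [Group.fg_iff_subgroup_fg, Subgroup.fg_iff]
    exact ⟨_, rfl, hfin⟩
  · obtain ⟨l, hl, h⟩ := hTt x (hle x.2)
    rw [isOfFinOrder_iff_pow_eq_one]
    exact ⟨l, hl, Subtype.ext h⟩

end Finiteness

/-! ### Uniform bounds by ultraproducts -/

section Ultraproduct

universe u

theorem exists_range_eq {β : Type*} {s : Set β} {m : ℕ} (hs : s.Nonempty) (hm : s.encard ≤ m) :
    ∃ f : Fin m → β, Set.range f = s := by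
  obtain ⟨hf, hc⟩ := Set.encard_le_coe_iff_finite_ncard_le.1 hm
  have := hf.fintype
  have := hs.to_subtype
  obtain ⟨i⟩ : Nonempty (s ↪ Fin m) := by
    refine Function.Embedding.nonempty_of_card_le ?_
    rw [Fintype.card_fin, ← Nat.card_eq_fintype_card]
    exact hc
  refine ⟨fun a => ((Function.invFun i a : s) : β), ?_⟩
  ext x
  constructor
  · rintro ⟨a, rfl⟩
    exact (Function.invFun i a).2
  · intro hx
    exact ⟨i ⟨x, hx⟩, by
      change ((Function.invFun i (i ⟨x, hx⟩) : s) : β) = x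
      rw [Function.leftInverse_invFun i.injective]⟩

variable {G : ℕ → Type u} [∀ ν, Group (G ν)]

/-- The kernel of the projection to the ultraproduct: the sequences that are eventually trivial
along a fixed nonprincipal ultrafilter. -/
def ultraKer (G : ℕ → Type u) [∀ ν, Group (G ν)] : Subgroup (∀ ν, G ν) where
  carrier := {x | ∀ᶠ ν in (Filter.hyperfilter ℕ : Filter ℕ), x ν = 1}
  one_mem' := Filter.Eventually.of_forall fun _ => rfl
  mul_mem' := fun ha hb => by
    filter_upwards [ha, hb] with ν h1 h2
    rw [Pi.mul_apply, h1, h2, one_mul]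
  inv_mem' := fun ha => by
    filter_upwards [ha] with ν h1
    rw [Pi.inv_apply, h1, inv_one]

instance : (ultraKer G).Normal := by
  refine ⟨fun x hx g => ?_⟩
  filter_upwards [hx] with ν h
  simp [h]

theorem ultra_eq_iff {x y : ∀ ν, G ν} :
    QuotientGroup.mk' (ultraKer G) x = QuotientGroup.mk' (ultraKer G) y ↔
      ∀ᶠ ν in (Filter.hyperfilter ℕ : Filter ℕ), x ν = y ν := by
  rw [QuotientGroup.mk'_apply, QuotientGroup.mk'_apply, QuotientGroup.eq]
  refine Filter.eventually_congr (Filter.Eventually.of_forall fun ν => ?_)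
  rw [Pi.mul_apply, Pi.inv_apply, inv_mul_eq_one]

/-- A sequence of elements of uniformly finite sets is constant along the ultrafilter. -/
theorem exists_eventually_eq {m : ℕ} (i : ℕ → Fin m) :
    ∃ a, ∀ᶠ ν in (Filter.hyperfilter ℕ : Filter ℕ), i ν = a :=
  Ultrafilter.eventually_exists_iff.1 (Filter.Eventually.of_forall fun ν => ⟨i ν, rfl⟩)

/-- Normal soluble subgroups of the same index and bounded derived length pass to the
ultraproduct. -/
theorem virtSol_ultraproduct {N : ∀ ν, Subgroup (G ν)} (hN : ∀ ν, (N ν).Normal) {s e : ℕ}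
    (he : 0 < e) (hidx : ∀ ν, (N ν).index = e) (hder : ∀ ν, derIter (N ν) s = ⊥) :
    VirtSol ((∀ ν, G ν) ⧸ ultraKer G) := by
  have hs := QuotientGroup.mk'_surjective (ultraKer G)
  have hpi : (pi Set.univ N).Normal := ⟨fun x hx g ν _ => (hN ν).conj_mem _ (hx ν trivial) _⟩
  refine ⟨(pi Set.univ N).map (QuotientGroup.mk' (ultraKer G)), hpi.map _ hs, ?_, s, ?_⟩
  · have hrep : ∀ ν, ∃ c : Fin e → G ν, ∀ g, ∃ i, (c i)⁻¹ * g ∈ N ν := by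
      intro ν
      have hfin : Finite (G ν ⧸ N ν) := Nat.finite_of_card_ne_zero (by
        change (N ν).index ≠ 0
        rw [hidx]
        exact he.ne')
      have eqv := Finite.equivFinOfCardEq (α := G ν ⧸ N ν) (n := e) (hidx ν)
      refine ⟨fun i => (eqv.symm i).out, fun g => ⟨eqv g, ?_⟩⟩
      rw [← QuotientGroup.eq]
      simp
    choose c hc using hrep
    refine @finiteIndex_of_finite_quotient _ _ _ ?_
    refine Finite.of_surjective (α := Fin e)
      (fun i => QuotientGroup.mk (QuotientGroup.mk' (ultraKer G) fun ν => c ν i)) fun x => ?_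
    obtain ⟨x, rfl⟩ := QuotientGroup.mk_surjective x
    obtain ⟨x, rfl⟩ := hs x
    choose i hi using fun ν => hc ν (x ν)
    obtain ⟨a, ha⟩ := exists_eventually_eq i
    classical
    refine ⟨a, QuotientGroup.eq.2 ⟨fun ν => if i ν = a then (c ν a)⁻¹ * x ν else 1, ?_, ?_⟩⟩
    · intro ν _
      dsimp only
      split_ifs with h
      · rw [← h]; exact hi ν
      · exact (N ν).one_mem
    · rw [← map_inv, ← map_mul, ultra_eq_iff]
      filter_upwards [ha] with ν h
      rw [if_pos h]; rfl
  · have hle : ∀ d, derIter (pi Set.univ N) d ≤ pi Set.univ fun ν => derIter (N ν) d := by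
      intro d
      induction d with
      | zero => exact le_rfl
      | succ d ih => exact (commutator_mono ih ih).trans (commutator_pi_pi_le _ _)
    rw [← map_derIter, eq_bot_iff, map_le_iff_le_comap]
    intro x hx
    have hx1 : x = 1 := by
      funext ν
      have : x ν ∈ derIter (N ν) s := hle s hx ν trivial
      rwa [hder ν, mem_bot] at this
    rw [hx1]
    exact one_mem _

/-- The bound in a family of groups comes from finiteness in the ultraproduct. -/
theorem exists_card_bound {α : Type*} [Fintype α] {t : CommTree α} (ht : t.Multilinear) {q n : ℕ}
    (hq : 0 < q) (hn : 0 < n) (m s e : ℕ) (he : 0 < e) :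
    ∃ ν : ℕ, ∀ (G : Type u) [Group G] (N : Subgroup G), N.Normal → N.index = e →
      derIter N s = ⊥ → (t.engelValues q n G).encard ≤ m →
      Finite (closure (t.engelValues q n G)) ∧
        Nat.card (closure (t.engelValues q n G)) ≤ ν := by
  by_contra hcon
  simp only [not_exists, not_forall] at hcon
  choose G _ N hN hidx hder hval hbad using hcon
  have hfval : ∀ ν, ∃ f : Fin m → G ν, Set.range f = t.engelValues q n (G ν) := fun ν =>
    exists_range_eq (Set.range_nonempty _) (hval ν)
  choose f hf using hfval
  let π := QuotientGroup.mk' (ultraKer G)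
  have hs : Function.Surjective π := QuotientGroup.mk'_surjective _
  have hVS : VirtSol ((∀ ν, G ν) ⧸ ultraKer G) := virtSol_ultraproduct hN he hidx hder
  have hvalue : ∀ (g : α → ∀ ν, G ν) (y : ∀ ν, G ν) (ν : ℕ),
      engelComm (t.eval g ^ q) y n ν = engelComm (t.eval (fun i => g i ν) ^ q) (y ν) n := by
    intro g y ν
    have := map_engelComm (Pi.evalMonoidHom G ν) (t.eval g ^ q) y n
    rwa [map_pow, CommTree.map_eval] at this
  have hπvalue : ∀ (g : α → ∀ ν, G ν) (y : ∀ ν, G ν), π (engelComm (t.eval g ^ q) y n) =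
      engelComm (t.eval (fun i => π (g i)) ^ q) (π y) n := by
    intro g y
    rw [map_engelComm, map_pow, CommTree.map_eval]
  -- the values in the ultraproduct are the `m` classes of the sequences `ν ↦ f ν i`
  have hfin : (t.engelValues q n ((∀ ν, G ν) ⧸ ultraKer G)).Finite := by
    refine (Set.finite_range fun i : Fin m => π fun ν => f ν i).subset ?_
    rintro _ ⟨⟨g, y⟩, rfl⟩
    choose g' hg' using fun i => hs (g i)
    obtain ⟨y', rfl⟩ := hs y
    have hmem : ∀ ν, ∃ i, f ν i = engelComm (t.eval g' ^ q) y' n ν := by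
      intro ν
      rw [← Set.mem_range, hf, hvalue]
      exact ⟨(_, _), rfl⟩
    choose i hi using hmem
    obtain ⟨a, ha⟩ := exists_eventually_eq i
    refine ⟨a, ?_⟩
    have h1 := hπvalue g' y'
    simp only [hg'] at h1
    refine Eq.trans (ultra_eq_iff.2 ?_) h1
    filter_upwards [ha] with ν h
    rw [← h, hi]
  have hfmem : ∀ i, π (fun ν => f ν i) ∈ t.engelValues q n ((∀ ν, G ν) ⧸ ultraKer G) := by
    intro i
    have h1 : ∀ ν, ∃ p : (α → G ν) × G ν, engelComm (t.eval p.1 ^ q) p.2 n = f ν i := by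
      intro ν
      have : f ν i ∈ Set.range (f ν) := ⟨i, rfl⟩
      rwa [hf] at this
    choose p hp using h1
    refine ⟨(fun j => π fun ν => (p ν).1 j, π fun ν => (p ν).2), ?_⟩
    exact (hπvalue (fun j ν => (p ν).1 j) fun ν => (p ν).2).symm.trans
      (congrArg π (funext fun ν => (hvalue _ _ ν).trans (hp ν)))
  have hfinite := hVS.finite_closure_engelValues ht hq hn hfin
  set V := closure (t.engelValues q n ((∀ ν, G ν) ⧸ ultraKer G)) with hV
  choose r hr using fun x : V => hs (x : (∀ ν, G ν) ⧸ ultraKer G)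
  have hfV : ∀ i, π (fun ν => f ν i) ∈ V := fun i => subset_closure (hfmem i)
  -- almost everywhere the representatives `r x` contain `1` and are closed under multiplication
  -- by the values and their inverses
  have h1 : ∀ᶠ ν in (Filter.hyperfilter ℕ : Filter ℕ), r 1 ν = 1 :=
    ultra_eq_iff.1 ((hr 1).trans (map_one π).symm)
  have h2 : ∀ᶠ ν in (Filter.hyperfilter ℕ : Filter ℕ), ∀ (x : V) (i : Fin m),
      r (x * ⟨_, hfV i⟩) ν = r x ν * f ν i :=
    Filter.eventually_all.2 fun x => Filter.eventually_all.2 fun i =>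
      (ultra_eq_iff (y := r x * fun ν => f ν i)).1 ((hr _).trans (by
        change _ = π _
        rw [map_mul, hr]; rfl))
  have h3 : ∀ᶠ ν in (Filter.hyperfilter ℕ : Filter ℕ), ∀ (x : V) (i : Fin m),
      r (x * ⟨_, hfV i⟩⁻¹) ν = r x ν * (f ν i)⁻¹ :=
    Filter.eventually_all.2 fun x => Filter.eventually_all.2 fun i =>
      (ultra_eq_iff (y := r x * (fun ν => f ν i)⁻¹)).1 ((hr _).trans (by
        change _ = π _
        rw [map_mul, map_inv, hr]; rfl))
  have h4 : ∀ᶠ ν in (Filter.hyperfilter ℕ : Filter ℕ), Nat.card V ≤ ν :=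
    Nat.hyperfilter_le_atTop (Filter.eventually_ge_atTop _)
  obtain ⟨ν, h1, h2, h3, h4⟩ := (h1.and (h2.and (h3.and h4))).exists
  have hsub : ∀ x ∈ closure (t.engelValues q n (G ν)), ∃ a : V, r a ν = x := by
    intro x hx
    induction hx using closure_induction_right with
    | one => exact ⟨1, h1⟩
    | mul_right x _ y hy ih =>
      obtain ⟨a, rfl⟩ := ih
      rw [← hf] at hy
      obtain ⟨i, rfl⟩ := hy
      exact ⟨_, h2 a i⟩
    | mul_inv_cancel x _ y hy ih =>
      obtain ⟨a, rfl⟩ := ih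
      rw [← hf] at hy
      obtain ⟨i, rfl⟩ := hy
      exact ⟨_, h3 a i⟩
  choose a ha using hsub
  have hinj : Function.Injective fun x : closure (t.engelValues q n (G ν)) => a x x.2 := by
    intro x y hxy
    refine Subtype.ext ?_
    rw [← ha x x.2, ← ha y y.2]
    exact congrArg (fun z => r z ν) hxy
  exact hbad ν ⟨Finite.of_injective _ hinj, (Nat.card_le_card_of_injective _ hinj).trans h4⟩

theorem wordValues_powEngelWord {α : Type*} (t : CommTree α) (q n : ℕ) (G : Type*) [Group G] :
    wordValues (powEngelWord (t.eval FreeGroup.of) q n) G = t.engelValues q n G := by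
  have key : ∀ g : Option α → G, FreeGroup.lift g (powEngelWord (t.eval FreeGroup.of) q n) =
      engelComm (t.eval (fun i => g (some i)) ^ q) (g none) n := by
    intro g
    rw [powEngelWord, map_engelComm, map_pow, CommTree.map_eval, CommTree.map_eval]
    simp
  ext x
  constructor
  · rintro ⟨g, rfl⟩
    exact ⟨(fun i => g (some i), g none), (key g).symm⟩
  · rintro ⟨⟨g, y⟩, rfl⟩
    exact ⟨fun o => o.elim y g, key _⟩

end Ultraproduct

end VerbalEngel

theorem proposition5p4 {k : ℕ} (w : FreeGroup (Fin k)) (hw : IsMultilinearComm w)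
    (n q : ℕ) (hn : 0 < n) (hq : 0 < q) (m s e : ℕ) (he : 0 < e) :
    ∃ ν : ℕ, ∀ (G : Type*) [Group G] (N : Subgroup G),
      N.Normal → N.index = e → derivedSeries N s = ⊥ →
      (wordValues (powEngelWord w q n) G).encard ≤ m →
      Finite (verbalSubgroup (powEngelWord w q n) G) ∧
        Nat.card (verbalSubgroup (powEngelWord w q n) G) ≤ ν := by
  obtain ⟨S, hS⟩ := hw
  obtain ⟨t, ht, -, rfl⟩ := VerbalEngel.CommTree.exists_of_multilinearCommOn hS
  obtain ⟨ν, hν⟩ := VerbalEngel.exists_card_bound ht hq hn m s e he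
  refine ⟨ν, fun G _ N hN hidx hder hval => ?_⟩
  rw [verbalSubgroup, VerbalEngel.wordValues_powEngelWord]
  rw [VerbalEngel.wordValues_powEngelWord] at hval
  exact hν G N hN hidx (by rw [VerbalEngel.derIter_eq_map, hder, Subgroup.map_bot]) hval
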